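/- All graphs are finite, undirected, without loops or multiple edges. A matching of a graph $G$ is a set of edges no two of which share a vertex; $\nu(G)$ is the largest number of edges in a matching of $G$, and a matching is maximum if it has $\nu(G)$ edges. For a set $F$ of edges let $G\setminus F$ be the graph obtained from $G$ by removing the edges in $F$, and put \[ L(G)=\max\{\nu(G\setminus F): F \text{ is a maximum matching of } G\},\qquad l(G)=\min\{\nu(G\setminus F): F \text{ is a maximum matching of } G\}. \] The property $L(G)=2\,l(G)$ can be tested in polynomial time. Precisely: there are a program for a random access machine (with unit-cost addition, truncated subtraction, indirect memory access and jumps, but without multiplication) and a polynomial $p$ such that for every $n\ge 0$ and every graph $G$ on $n$ vertices, given by $n$ and its adjacency matrix, the program halts after at most $p(n)$ steps, with output $1$ if $L(G)=2\,l(G)$ and with output $0$ otherwise. -/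

import Mathlib

noncomputable section

/-! ### Matchings, `ν(G)`, `L(G)` and `l(G)` -/

namespace MatchingPairs

variable {V : Type*}

/-- A matching of `G`: a finite set of edges of `G`, no two of which share a vertex. -/
def IsMatching (G : SimpleGraph V) (M : Finset (Sym2 V)) : Prop :=
  (∀ e ∈ M, e ∈ G.edgeSet) ∧
    ∀ e ∈ M, ∀ f ∈ M, e ≠ f → ∀ v : V, ¬ (v ∈ e ∧ v ∈ f)

/-- `ν(G)`: the cardinality of a largest matching of `G`
(`V` is finite in all uses, so that the set is bounded; it contains `0`). -/
def matchingNumber (G : SimpleGraph V) : ℕ :=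
  sSup {k : ℕ | ∃ M : Finset (Sym2 V), IsMatching G M ∧ M.card = k}

/-- A maximum matching of `G`: a matching with `ν(G)` edges. -/
def IsMaximumMatching (G : SimpleGraph V) (F : Finset (Sym2 V)) : Prop :=
  IsMatching G F ∧ F.card = matchingNumber G

/-- The numbers `ν(G \ F)`, where `F` runs over the maximum matchings of `G`. -/
def residualMatchingNumbers (G : SimpleGraph V) : Set ℕ :=
  {k : ℕ | ∃ F : Finset (Sym2 V), IsMaximumMatching G F ∧
    matchingNumber (G.deleteEdges (F : Set (Sym2 V))) = k}

/-- `L(G) = max {ν(G \ F) : F a maximum matching of G}`. -/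
def bigL (G : SimpleGraph V) : ℕ := sSup (residualMatchingNumbers G)

/-- `l(G) = min {ν(G \ F) : F a maximum matching of G}`. -/
def smallL (G : SimpleGraph V) : ℕ := sInf (residualMatchingNumbers G)

end MatchingPairs

/-! ### Random access machines and polynomial time

The machine has registers `R 0, R 1, …`, of which a program can name only finitely many, and a
memory `M 0, M 1, …`, which is accessed only through an address held in a register. Every
instruction costs one step. There is no multiplication: in `t` steps the bit length of the numbers
grows by at most `t` plus a constant, so that polynomial time on this machine is the same as
polynomial time on a Turing machine. -/

namespace RAM

/-- The instructions. -/
inductive Instr where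
  /-- `R d := c` -/
  | const (d c : ℕ)
  /-- `R d := R a + R b` -/
  | add (d a b : ℕ)
  /-- `R d := max (R a - R b) 0` -/
  | sub (d a b : ℕ)
  /-- `R d := M (R a)` -/
  | load (d a : ℕ)
  /-- `M (R d) := R a` -/
  | store (d a : ℕ)
  /-- go to instruction `l` -/
  | jump (l : ℕ)
  /-- if `R a = 0`, go to instruction `l`, otherwise to the next instruction -/
  | jumpIfZero (a l : ℕ)

/-- A program is a finite list of instructions, numbered from `0`. -/
abbrev Program := List Instr

/-- A configuration: program counter, contents of the registers, contents of the memory. -/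
structure Config where
  pc : ℕ
  reg : ℕ → ℕ
  mem : ℕ → ℕ

/-- The effect of one instruction. -/
def exec (c : Config) : Instr → Config
  | .const d k => ⟨c.pc + 1, Function.update c.reg d k, c.mem⟩
  | .add d a b => ⟨c.pc + 1, Function.update c.reg d (c.reg a + c.reg b), c.mem⟩
  | .sub d a b => ⟨c.pc + 1, Function.update c.reg d (c.reg a - c.reg b), c.mem⟩
  | .load d a => ⟨c.pc + 1, Function.update c.reg d (c.mem (c.reg a)), c.mem⟩
  | .store d a => ⟨c.pc + 1, c.reg, Function.update c.mem (c.reg d) (c.reg a)⟩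
  | .jump l => ⟨l, c.reg, c.mem⟩
  | .jumpIfZero a l => ⟨if c.reg a = 0 then l else c.pc + 1, c.reg, c.mem⟩

/-- The machine halts when the program counter leaves the program. -/
def Halted (P : Program) (c : Config) : Prop := P.length ≤ c.pc

/-- One step of the machine; a halted configuration does not change any more. -/
def step (P : Program) (c : Config) : Config :=
  match P[c.pc]? with
  | none => c
  | some i => exec c i

/-- The configuration after `t` steps. -/
def run (P : Program) (t : ℕ) (c : Config) : Config := (step P)^[t] c

open Classical in
/-- The input for a graph `G` on the vertices `0, …, n - 1`: register `0` holds `n`, memory cell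
`i * n + j` with `i, j < n` holds the entry `(i, j)` of the adjacency matrix of `G`, and everything
else is `0`. -/
def input {n : ℕ} (G : SimpleGraph (Fin n)) : Config where
  pc := 0
  reg := fun r => if r = 0 then n else 0
  mem := fun a => if ∃ i j : Fin n, a = (i : ℕ) * n + (j : ℕ) ∧ G.Adj i j then 1 else 0

/-- On every graph, `P` halts after at most `T n` steps, where `n` is the number of vertices, with
`1` in register `0` if the graph has the property `Q`, and with `0` in register `0` if not. -/
def DecidesInTime (P : Program) (Q : ∀ n : ℕ, SimpleGraph (Fin n) → Prop) (T : ℕ → ℕ) : Prop :=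
  ∀ (n : ℕ) (G : SimpleGraph (Fin n)), ∃ t ≤ T n,
    Halted P (run P t (input G)) ∧
      (Q n G → (run P t (input G)).reg 0 = 1) ∧
      (¬ Q n G → (run P t (input G)).reg 0 = 0)

/-- The graph property `Q` can be tested in polynomial time: a single program decides it for all
graphs, in a number of steps bounded by a polynomial in the number of vertices. (As the input
consists of `n` and the `n ^ 2` entries of the adjacency matrix, this is the same as a polynomial in
the size of the input.) -/
def DecidableInPolyTime (Q : ∀ n : ℕ, SimpleGraph (Fin n) → Prop) : Prop :=
  ∃ (P : Program) (p : Polynomial ℕ), DecidesInTime P Q fun n => p.eval n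

end RAM

end

/-!
Let `F` and `F'` be maximum matchings of `G`, and let `H` be a matching disjoint from `F'`. Then
`H ∩ F ⊆ F \ F'`, and `F \ F'` is as large as `F' \ F`. Hence
`|H| ≤ |F' \ F| + |H \ F| ≤ 2 ν(G \ F)`, which gives `L(G) ≤ 2 l(G)`. In the equality case,
`F' \ F` and `H \ F` are maximum matchings of `G \ F`, and every edge of `H \ F` contains a vertex
`v`, exposed by `F`, that is joined by an edge of `F' \ F` and an edge of `H \ F` to two vertices
on different edges of `F`. There are `ν(G \ F)` such vertices `v`, and all the edges of `F` reached
from them are distinct. Conversely, given such a system of pairs of neighbours, one can exchange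
the edges of `F` on one side of the pairs, and a matching of size `2 ν(G \ F)` avoids the new
maximum matching.

In this situation the edges of `F` are recognized locally: they are exactly the edges with an end
of degree one, or with two ends of degree two that have a common neighbour. So `L(G) = 2 l(G)`
means that some local conditions on these tight edges hold and that the remaining vertices of
positive degree can choose two neighbours each, all on different tight edges. The choice is a
matching in a bipartite graph, whose existence an auction decides in polynomially many rounds:
bidders who own nothing bid for a cheapest acceptable object, and if a matching exists, prices
never exceed the number of bidders. On the machine, the conditions are evaluated as formulas with
quantifiers over the vertices, and the auction as a nest of loops over the vertices.
-/

namespace RAM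

/-! ### A loop language and its compilation -/

/-- Expressions over named variables, the input size and the memory. They have no side effects, and
a bounded sum is the only iteration; it doubles as the bounded existential quantifier. -/
inductive Expr where
  /-- the input size `n` -/
  | size
  | var (x : ℕ)
  | const (c : ℕ)
  | add (a b : Expr)
  | sub (a b : Expr)
  /-- the memory cell with the given address -/
  | read (a : Expr)
  /-- `a` if `c = 0`, otherwise `b` -/
  | ifz (c a b : Expr)
  /-- the sum of `e` over all `x < n` -/
  | sum (x : ℕ) (e : Expr)

/-- Commands; they only change the memory, and every loop runs `n` times, so that every command
takes polynomial time. -/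
inductive Cmd where
  /-- assign the value of `e` to the memory cell `a` -/
  | store (a e : Expr)
  | seq (c d : Cmd)
  /-- execute `c` if `e ≠ 0` -/
  | when (e : Expr) (c : Cmd)
  /-- execute `c` for `x = 0, …, n - 1` -/
  | loop (x : ℕ) (c : Cmd)

/-- The value of an expression for the input size `n`, the memory `m` and the values `ρ` of the
variables. -/
def Expr.eval (n : ℕ) (m : ℕ → ℕ) : Expr → (ℕ → ℕ) → ℕ
  | .size, _ => n
  | .var x, ρ => ρ x
  | .const c, _ => c
  | .add a b, ρ => a.eval n m ρ + b.eval n m ρ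
  | .sub a b, ρ => a.eval n m ρ - b.eval n m ρ
  | .read a, ρ => m (a.eval n m ρ)
  | .ifz c a b, ρ => if c.eval n m ρ = 0 then a.eval n m ρ else b.eval n m ρ
  | .sum x e, ρ => ∑ i ∈ Finset.range n, e.eval n m (Function.update ρ x i)

/-- The memory after the execution of a command. -/
def Cmd.eval (n : ℕ) : Cmd → (ℕ → ℕ) → (ℕ → ℕ) → (ℕ → ℕ)
  | .store a e, ρ, m => Function.update m (a.eval n m ρ) (e.eval n m ρ)
  | .seq c d, ρ, m => d.eval n ρ (c.eval n ρ m)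
  | .when e c, ρ, m => if e.eval n m ρ = 0 then m else c.eval n ρ m
  | .loop x c, ρ, m =>
      (List.range n).foldl (fun m i => c.eval n (Function.update ρ x i) m) m

/-- The register of a variable. Register `0` is left to the input size. -/
def vreg (x : ℕ) : ℕ := 2 * x + 2

/-- The register of a temporary value. -/
def treg (t : ℕ) : ℕ := 2 * t + 1

/-- The registers of the temporaries from `t` on: those which code compiled with base `t` may
overwrite. -/
def scratch (t : ℕ) : Set ℕ := {a | ∃ s, t ≤ s ∧ a = treg s}

@[simp] lemma vreg_ne_treg (x t : ℕ) : vreg x ≠ treg t := by unfold vreg treg; omega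
@[simp] lemma treg_ne_vreg (x t : ℕ) : treg t ≠ vreg x := (vreg_ne_treg x t).symm
@[simp] lemma vreg_inj {x y : ℕ} : vreg x = vreg y ↔ x = y := by unfold vreg; omega
@[simp] lemma treg_inj {s t : ℕ} : treg s = treg t ↔ s = t := by unfold treg; omega
@[simp] lemma zero_ne_vreg (x : ℕ) : 0 ≠ vreg x := by unfold vreg; omega
@[simp] lemma zero_ne_treg (t : ℕ) : 0 ≠ treg t := by unfold treg; omega

@[simp] lemma vreg_notMem_scratch (x t : ℕ) : vreg x ∉ scratch t := by simp [scratch]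
@[simp] lemma zero_notMem_scratch (t : ℕ) : 0 ∉ scratch t := by simp [scratch]
@[simp] lemma treg_mem_scratch {s t : ℕ} : treg s ∈ scratch t ↔ t ≤ s := by simp [scratch]

lemma scratch_anti {s t : ℕ} (h : s ≤ t) : scratch t ⊆ scratch s :=
  fun _ ⟨u, hu, e⟩ => ⟨u, h.trans hu, e⟩

/-- `R d := R a`, for `d ≠ a`. -/
def moveCode (d a : ℕ) : List Instr := [.const d 0, .add d d a]

/-- Code at address `k` that executes `B` for all values of the variable `x` below the input size.
The temporary `t` keeps the previous value of `x`, and `t + 1` is used for the test and the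
increment. -/
def loopCode (k x t : ℕ) (B : List Instr) : List Instr :=
  moveCode (treg t) (vreg x) ++ [.const (vreg x) 0,
    .sub (treg (t + 1)) 0 (vreg x), .jumpIfZero (treg (t + 1)) (k + 5 + B.length + 3)] ++ B ++
  [.const (treg (t + 1)) 1, .add (vreg x) (vreg x) (treg (t + 1)), .jump (k + 3)] ++
  moveCode (vreg x) (treg t)

/-- Code at address `k` that puts the value of an expression into the temporary `t`. -/
def Expr.compile : Expr → ℕ → ℕ → List Instr
  | .size, _, t => moveCode (treg t) 0
  | .var x, _, t => moveCode (treg t) (vreg x)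
  | .const c, _, t => [.const (treg t) c]
  | .add a b, k, t =>
      a.compile k t ++ b.compile (k + (a.compile k t).length) (t + 1) ++
        [.add (treg t) (treg t) (treg (t + 1))]
  | .sub a b, k, t =>
      a.compile k t ++ b.compile (k + (a.compile k t).length) (t + 1) ++
        [.sub (treg t) (treg t) (treg (t + 1))]
  | .read a, k, t => a.compile k t ++ [.load (treg t) (treg t)]
  | .ifz c a b, k, t =>
      let C := c.compile k t
      let B := b.compile (k + C.length + 1) t
      let A := a.compile (k + C.length + 1 + B.length + 1) t
      C ++ .jumpIfZero (treg t) (k + C.length + 1 + B.length + 1) ::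
        (B ++ .jump (k + C.length + 1 + B.length + 1 + A.length) :: A)
  | .sum x e, k, t =>
      .const (treg t) 0 :: loopCode (k + 1) x (t + 1)
        (e.compile (k + 6) (t + 3) ++ [.add (treg t) (treg t) (treg (t + 3))])

/-- Code at address `k` that executes a command, using only temporaries from `t` on. -/
def Cmd.compile : Cmd → ℕ → ℕ → List Instr
  | .store a e, k, t =>
      a.compile k t ++ e.compile (k + (a.compile k t).length) (t + 1) ++
        [.store (treg t) (treg (t + 1))]
  | .seq c d, k, t => c.compile k t ++ d.compile (k + (c.compile k t).length) t
  | .when e c, k, t =>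
      let E := e.compile k t
      let C := c.compile (k + E.length + 1) t
      E ++ .jumpIfZero (treg t) (k + E.length + 1 + C.length) :: C
  | .loop x c, k, t => loopCode k x t (c.compile (k + 5) (t + 2))

open Polynomial in
/-- A bound for the number of steps of the compiled expression. -/
noncomputable def Expr.cost : Expr → Polynomial ℕ
  | .size => 2
  | .var _ => 2
  | .const _ => 1
  | .add a b => a.cost + b.cost + 1
  | .sub a b => a.cost + b.cost + 1
  | .read a => a.cost + 1
  | .ifz c a b => c.cost + a.cost + b.cost + 2
  | .sum _ e => X * (e.cost + 6) + 8

open Polynomial in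
/-- A bound for the number of steps of the compiled command. -/
noncomputable def Cmd.cost : Cmd → Polynomial ℕ
  | .store a e => a.cost + e.cost + 1
  | .seq c d => c.cost + d.cost
  | .when e c => e.cost + c.cost + 1
  | .loop _ c => X * (c.cost + 5) + 7

/-- The instructions `l` stand at address `k` of `P`. -/
def CodeAt (P : Program) (k : ℕ) (l : List Instr) : Prop := l <+: P.drop k

lemma codeAt_self (P : Program) : CodeAt P 0 P := List.prefix_rfl

@[simp] lemma codeAt_nil (P : Program) (k : ℕ) : CodeAt P k [] := List.nil_prefix

@[simp] lemma codeAt_cons {P : Program} {k : ℕ} {i : Instr} {l : List Instr} :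
    CodeAt P k (i :: l) ↔ P[k]? = some i ∧ CodeAt P (k + 1) l := by
  rw [CodeAt, CodeAt, ← List.head?_drop, ← List.tail_drop]
  cases P.drop k <;> simp [List.cons_prefix_cons, eq_comm]

@[simp] lemma codeAt_append {P : Program} {k : ℕ} {l l' : List Instr} :
    CodeAt P k (l ++ l') ↔ CodeAt P k l ∧ CodeAt P (k + l.length) l' := by
  induction l generalizing k with
  | nil => simp [CodeAt]
  | cons i l ih => simp [ih, and_assoc, add_assoc, add_comm 1]

/-- `P` takes the configuration `c` to `c'` in at most `T` steps. -/
def Reaches (P : Program) (T : ℕ) (c c' : Config) : Prop := ∃ t ≤ T, run P t c = c'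

section Reaches

variable {P : Program} {T T' k k' : ℕ} {c c' c'' : Config} {r r' m m' : ℕ → ℕ}

lemma Reaches.trans (h : Reaches P T c c') (h' : Reaches P T' c' c'') :
    Reaches P (T + T') c c'' := by
  obtain ⟨t, ht, rfl⟩ := h
  obtain ⟨s, hs, rfl⟩ := h'
  exact ⟨s + t, by omega, Function.iterate_add_apply ..⟩

lemma Reaches.of_le_of_eq (h : Reaches P T c ⟨k, r, m⟩) (hT : T ≤ T') (hk : k = k') :
    Reaches P T' c ⟨k', r, m⟩ := by
  obtain ⟨t, ht, e⟩ := h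
  exact ⟨t, ht.trans hT, hk ▸ e⟩

lemma reaches_exec {i : Instr} (hi : P[k]? = some i) :
    Reaches P 1 ⟨k, r, m⟩ (exec ⟨k, r, m⟩ i) :=
  ⟨1, le_rfl, by simp [run, step, hi]⟩

lemma reaches_moveCode {d a : ℕ} (hP : CodeAt P k (moveCode d a)) (hda : a ≠ d) :
    Reaches P 2 ⟨k, r, m⟩ ⟨k + 2, Function.update r d (r a), m⟩ := by
  obtain ⟨h0, h1, -⟩ := by simpa only [moveCode, codeAt_cons] using hP
  simpa [exec, hda] using (reaches_exec h0 (r := r) (m := m)).trans (reaches_exec h1)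

end Reaches

/-- The registers `r` hold the input size `n` and the values `ρ` of the variables. -/
def Agrees (n : ℕ) (ρ r : ℕ → ℕ) : Prop := r 0 = n ∧ ∀ x, r (vreg x) = ρ x

lemma Agrees.congr {n t : ℕ} {ρ r r' : ℕ → ℕ} (h : Agrees n ρ r)
    (hr : Set.EqOn r r' (scratch t)ᶜ) : Agrees n ρ r' :=
  ⟨by rw [← hr (by simp), h.1], fun x => by rw [← hr (by simp), h.2]⟩

lemma Agrees.update {n t x i : ℕ} {ρ r r' : ℕ → ℕ} (h : Agrees n ρ r)
    (hr : Set.EqOn r r' (insert (vreg x) (scratch t))ᶜ) (hx : r' (vreg x) = i) :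
    Agrees n (Function.update ρ x i) r' := by
  refine ⟨by rw [← hr (by simp), h.1], fun y => ?_⟩
  rcases eq_or_ne y x with rfl | hy
  · simpa using hx
  · rw [← hr (by simp [hy]), h.2, Function.update_of_ne hy]

lemma eqOn_update {r r' : ℕ → ℕ} {S : Set ℕ} (h : Set.EqOn r r' Sᶜ) {a : ℕ} (v : ℕ) (ha : a ∈ S) :
    Set.EqOn r (Function.update r' a v) Sᶜ := fun b hb => by
  rw [Function.update_of_ne (ne_of_mem_of_not_mem ha hb).symm, h hb]

lemma eqOn_scratch_anti {r r' : ℕ → ℕ} {s t : ℕ} (h : Set.EqOn r r' (scratch t)ᶜ) (hst : s ≤ t) :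
    Set.EqOn r r' (scratch s)ᶜ :=
  h.mono (Set.compl_subset_compl.2 (scratch_anti hst))

section Loop

/-- `Inv i` holds before the pass with `x = i` of the loop at address `k` with body `B` and base
`t`: it does not depend on the registers that belong to the loop, and the body, which takes at most
`T` steps, leads from `Inv i` to `Inv (i + 1)`. -/
structure LoopInvariant (P : Program) (n k x t T : ℕ) (B : List Instr)
    (Inv : ℕ → (ℕ → ℕ) → (ℕ → ℕ) → Prop) : Prop where
  size_eq {i : ℕ} {r m : ℕ → ℕ} : Inv i r m → r 0 = n
  congr {i : ℕ} {r r' m : ℕ → ℕ} : Set.EqOn r r' {vreg x, treg t, treg (t + 1)}ᶜ →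
    Inv i r m → Inv i r' m
  body {i : ℕ} {r m : ℕ → ℕ} : i < n → r (vreg x) = i → Inv i r m →
    ∃ r' m', Reaches P T ⟨k + 5, r, m⟩ ⟨k + 5 + B.length, r', m'⟩ ∧ r' (vreg x) = i ∧
      r' (treg t) = r (treg t) ∧ Inv (i + 1) r' m'

variable {P : Program} {n k x t T i : ℕ} {B : List Instr} {Inv : ℕ → (ℕ → ℕ) → (ℕ → ℕ) → Prop}
  {r m : ℕ → ℕ}

lemma codeAt_loopCode : CodeAt P k (loopCode k x t B) ↔
    CodeAt P k (moveCode (treg t) (vreg x)) ∧ P[k + 2]? = some (.const (vreg x) 0) ∧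
    P[k + 3]? = some (.sub (treg (t + 1)) 0 (vreg x)) ∧
    P[k + 4]? = some (.jumpIfZero (treg (t + 1)) (k + 5 + B.length + 3)) ∧
    CodeAt P (k + 5) B ∧
    P[k + 5 + B.length]? = some (.const (treg (t + 1)) 1) ∧
    P[k + 5 + B.length + 1]? = some (.add (vreg x) (vreg x) (treg (t + 1))) ∧
    P[k + 5 + B.length + 2]? = some (.jump (k + 3)) ∧
    CodeAt P (k + 5 + B.length + 3) (moveCode (vreg x) (treg t)) := by
  simp [loopCode, moveCode, and_assoc, add_comm, add_left_comm]

lemma length_loopCode : (loopCode k x t B).length = B.length + 10 := by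
  simp [loopCode, moveCode]

lemma reaches_loop_test (hP : CodeAt P k (loopCode k x t B)) (hn : r 0 = n) (hx : r (vreg x) = i) :
    Reaches P 2 ⟨k + 3, r, m⟩ ⟨if n - i = 0 then k + 5 + B.length + 3 else k + 5,
      Function.update r (treg (t + 1)) (n - i), m⟩ := by
  obtain ⟨-, -, h3, h4, -⟩ := codeAt_loopCode.1 hP
  simpa [exec, hn, hx] using (reaches_exec h3 (r := r) (m := m)).trans (reaches_exec h4)

lemma LoopInvariant.reaches_iteration (h : LoopInvariant P n k x t T B Inv)
    (hP : CodeAt P k (loopCode k x t B)) (hi : i < n) (hx : r (vreg x) = i) (hI : Inv i r m) :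
    ∃ r' m', Reaches P (T + 5) ⟨k + 3, r, m⟩ ⟨k + 3, r', m'⟩ ∧ r' (vreg x) = i + 1 ∧
      r' (treg t) = r (treg t) ∧ Inv (i + 1) r' m' := by
  obtain ⟨-, -, -, -, -, h5, h6, h7, -⟩ := codeAt_loopCode.1 hP
  have htest := reaches_loop_test (m := m) hP (h.size_eq hI) hx
  rw [if_neg (by omega)] at htest
  obtain ⟨r₁, m₁, hbody, hx₁, ht₁, hI₁⟩ := h.body (r := Function.update r (treg (t + 1)) (n - i))
    hi (by simpa using hx) (h.congr (eqOn_update (Set.eqOn_refl ..) _ (by simp)) hI)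
  have hincr := ((reaches_exec h5 (r := r₁) (m := m₁)).trans (reaches_exec h6)).trans
    (reaches_exec h7)
  refine ⟨_, _, ((htest.trans hbody).trans hincr).of_le_of_eq (by omega) rfl, ?_, ?_, ?_⟩
  · simp [hx₁]
  · simpa [exec] using ht₁
  · exact h.congr (eqOn_update (eqOn_update (Set.eqOn_refl ..) _ (by simp)) _ (by simp)) hI₁

lemma LoopInvariant.reaches_exit (h : LoopInvariant P n k x t T B Inv)
    (hP : CodeAt P k (loopCode k x t B)) (j : ℕ) (hij : i + j = n) (hx : r (vreg x) = i)
    (hI : Inv i r m) :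
    ∃ r' m', Reaches P (j * (T + 5) + 2) ⟨k + 3, r, m⟩ ⟨k + 5 + B.length + 3, r', m'⟩ ∧
      r' (treg t) = r (treg t) ∧ Inv n r' m' := by
  induction j generalizing i r m with
  | zero =>
    have htest := reaches_loop_test (m := m) hP (h.size_eq hI) hx
    rw [if_pos (by omega)] at htest
    obtain rfl : i = n := by omega
    exact ⟨_, m, htest.of_le_of_eq (by omega) rfl, by simp,
      h.congr (eqOn_update (Set.eqOn_refl ..) _ (by simp)) hI⟩
  | succ j ih =>
    obtain ⟨r₁, m₁, hR₁, hx₁, ht₁, hI₁⟩ := h.reaches_iteration hP (by omega) hx hI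
    obtain ⟨r₂, m₂, hR₂, ht₂, hI₂⟩ := ih (by omega) hx₁ hI₁
    exact ⟨r₂, m₂, (hR₁.trans hR₂).of_le_of_eq (by rw [Nat.succ_mul]; omega) rfl,
      ht₂.trans ht₁, hI₂⟩

theorem LoopInvariant.reaches_end (h : LoopInvariant P n k x t T B Inv)
    (hP : CodeAt P k (loopCode k x t B)) (hI : Inv 0 r m) :
    ∃ r' m', Reaches P (n * (T + 5) + 7) ⟨k, r, m⟩ ⟨k + (loopCode k x t B).length, r', m'⟩ ∧
      r' (vreg x) = r (vreg x) ∧ Inv n r' m' := by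
  obtain ⟨hsave, h2, -, -, -, -, -, -, hrestore⟩ := codeAt_loopCode.1 hP
  have hstart := (reaches_moveCode hsave (by simp)).trans (reaches_exec h2)
    (c := ⟨k, r, m⟩)
  obtain ⟨r₁, m₁, hloop, ht, hI₁⟩ := h.reaches_exit hP n (zero_add n)
    (r := Function.update (Function.update r (treg t) (r (vreg x))) (vreg x) 0)
    (Function.update_self ..)
    (h.congr (eqOn_update (eqOn_update (Set.eqOn_refl ..) _ (by simp)) _ (by simp)) hI)
  refine ⟨_, m₁, ((hstart.trans hloop).trans (reaches_moveCode hrestore (by simp))).of_le_of_eq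
    (by omega) (by rw [length_loopCode]; omega), by simpa using ht,
    h.congr (eqOn_update (Set.eqOn_refl ..) _ (by simp)) hI₁⟩

end Loop

/-- The compiled expression is correct: in `P`, and for input size `n` and memory `m`, it takes at
most `e.cost` steps, puts the value of `e` into the temporary `t` and changes nothing else that
is in use. -/
def Expr.Correct (P : Program) (n : ℕ) (m : ℕ → ℕ) (e : Expr) : Prop :=
  ∀ ⦃k t : ℕ⦄ ⦃ρ r : ℕ → ℕ⦄, CodeAt P k (e.compile k t) → Agrees n ρ r →
    ∃ r', Reaches P (e.cost.eval n) ⟨k, r, m⟩ ⟨k + (e.compile k t).length, r', m⟩ ∧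
      Set.EqOn r r' (scratch t)ᶜ ∧ r' (treg t) = e.eval n m ρ

namespace Expr.Correct

variable {P : Program} {n : ℕ} {m : ℕ → ℕ} {a b c e : Expr}

lemma size : Correct P n m size := by
  intro k t ρ r hP hr
  exact ⟨_, (reaches_moveCode hP (by simp)).of_le_of_eq (by simp [cost]) rfl,
    eqOn_update (Set.eqOn_refl ..) _ (by simp), by simp [eval, hr.1]⟩

lemma var (x : ℕ) : Correct P n m (var x) := by
  intro k t ρ r hP hr
  exact ⟨_, (reaches_moveCode hP (by simp)).of_le_of_eq (by simp [cost]) rfl,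
    eqOn_update (Set.eqOn_refl ..) _ (by simp), by simp [eval, hr.2]⟩

lemma const (v : ℕ) : Correct P n m (const v) := by
  intro k t ρ r hP _
  exact ⟨_, (reaches_exec (codeAt_cons.1 hP).1).of_le_of_eq (by simp [cost]) rfl,
    eqOn_update (Set.eqOn_refl ..) _ (by simp), by simp [eval]⟩

lemma pair (ha : Correct P n m a) (hb : Correct P n m b) {k t : ℕ} {ρ r : ℕ → ℕ}
    (hPa : CodeAt P k (a.compile k t))
    (hPb : CodeAt P (k + (a.compile k t).length) (b.compile (k + (a.compile k t).length) (t + 1)))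
    (hr : Agrees n ρ r) :
    ∃ r', Reaches P (a.cost.eval n + b.cost.eval n) ⟨k, r, m⟩
        ⟨k + (a.compile k t ++ b.compile (k + (a.compile k t).length) (t + 1)).length, r', m⟩ ∧
      Set.EqOn r r' (scratch t)ᶜ ∧ r' (treg t) = a.eval n m ρ ∧
      r' (treg (t + 1)) = b.eval n m ρ := by
  obtain ⟨r₁, hR₁, hs₁, hv₁⟩ := ha hPa hr
  obtain ⟨r₂, hR₂, hs₂, hv₂⟩ := hb hPb (hr.congr hs₁)
  refine ⟨r₂, (hR₁.trans hR₂).of_le_of_eq le_rfl (by simp [add_assoc]),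
    hs₁.trans (eqOn_scratch_anti hs₂ (by omega)), ?_, hv₂⟩
  rw [← hv₁, hs₂ (by simp)]

lemma add (ha : Correct P n m a) (hb : Correct P n m b) : Correct P n m (add a b) := by
  intro k t ρ r hP hr
  simp only [compile, codeAt_append, codeAt_cons] at hP
  obtain ⟨⟨hPa, hPb⟩, hi, -⟩ := hP
  obtain ⟨r₁, hR, hs, hva, hvb⟩ := ha.pair hb hPa hPb hr
  exact ⟨_, (hR.trans (reaches_exec hi)).of_le_of_eq (by simp [cost])
    (by simp [compile, add_assoc]), eqOn_update hs _ (by simp), by simp [eval, hva, hvb]⟩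

lemma sub (ha : Correct P n m a) (hb : Correct P n m b) : Correct P n m (sub a b) := by
  intro k t ρ r hP hr
  simp only [compile, codeAt_append, codeAt_cons] at hP
  obtain ⟨⟨hPa, hPb⟩, hi, -⟩ := hP
  obtain ⟨r₁, hR, hs, hva, hvb⟩ := ha.pair hb hPa hPb hr
  exact ⟨_, (hR.trans (reaches_exec hi)).of_le_of_eq (by simp [cost])
    (by simp [compile, add_assoc]), eqOn_update hs _ (by simp), by simp [eval, hva, hvb]⟩

lemma read (ha : Correct P n m a) : Correct P n m (read a) := by
  intro k t ρ r hP hr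
  simp only [compile, codeAt_append, codeAt_cons] at hP
  obtain ⟨hPa, hi, -⟩ := hP
  obtain ⟨r₁, hR, hs, hv⟩ := ha hPa hr
  exact ⟨_, (hR.trans (reaches_exec hi)).of_le_of_eq (by simp [cost])
    (by simp [compile, add_assoc]), eqOn_update hs _ (by simp), by simp [eval, hv]⟩

lemma ifz (hc : Correct P n m c) (ha : Correct P n m a) (hb : Correct P n m b) :
    Correct P n m (ifz c a b) := by
  intro k t ρ r hP hr
  simp only [compile, codeAt_append, codeAt_cons] at hP
  obtain ⟨hPc, hjz, hPb, hj, hPa⟩ := hP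
  obtain ⟨r₁, hR₁, hs₁, hv₁⟩ := hc hPc hr
  have htest := hR₁.trans (reaches_exec hjz)
  by_cases h : c.eval n m ρ = 0
  · obtain ⟨r₂, hR₂, hs₂, hv₂⟩ := ha hPa (hr.congr hs₁)
    simp only [exec, hv₁, h, if_true] at htest
    exact ⟨r₂, (htest.trans hR₂).of_le_of_eq (by simp [cost]; omega) (by simp [compile]; omega),
      hs₁.trans hs₂, by simp [eval, h, hv₂]⟩
  · obtain ⟨r₂, hR₂, hs₂, hv₂⟩ := hb hPb (hr.congr hs₁)
    simp only [exec, hv₁, h, if_false] at htest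
    exact ⟨r₂, ((htest.trans hR₂).trans (reaches_exec hj)).of_le_of_eq (by simp [cost]; omega)
      (by simp [compile]; omega), hs₁.trans hs₂, by simp [eval, h, hv₂]⟩

lemma loopInvariant_sum (he : Correct P n m e) {k t x : ℕ} {ρ r : ℕ → ℕ} (hr : Agrees n ρ r)
    (hP : CodeAt P k (loopCode k x (t + 1)
      (e.compile (k + 5) (t + 3) ++ [.add (treg t) (treg t) (treg (t + 3))]))) :
    LoopInvariant P n k x (t + 1) (e.cost.eval n + 1)
      (e.compile (k + 5) (t + 3) ++ [.add (treg t) (treg t) (treg (t + 3))])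
      (fun i r' m' => m' = m ∧ Set.EqOn r r' (insert (vreg x) (scratch t))ᶜ ∧
        r' (treg t) = ∑ j ∈ Finset.range i, e.eval n m (Function.update ρ x j)) where
  size_eq := fun ⟨_, hs, _⟩ => by rw [← hs (by simp), hr.1]
  congr := fun hr' ⟨hm, hs, hv⟩ => ⟨hm,
    hs.trans (hr'.mono (Set.compl_subset_compl.2 (by simp [Set.insert_subset_iff]; omega))), by
      rw [← hr' (by simp; omega), hv]⟩
  body := by
    rintro i r₁ m' - hx ⟨rfl, hs₁, hv₁⟩
    obtain ⟨-, -, -, -, hB, -⟩ := codeAt_loopCode.1 hP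
    obtain ⟨hPe, hadd, -⟩ := by simpa only [codeAt_append, codeAt_cons] using hB
    obtain ⟨r₂, hR₂, hs₂, hv₂⟩ := he hPe (hr.update hs₁ hx)
    have hkeep {a : ℕ} (ha : a ∉ scratch (t + 3)) : r₂ a = r₁ a := (hs₂ ha).symm
    refine ⟨_, m', (hR₂.trans (reaches_exec hadd)).of_le_of_eq le_rfl (by simp [add_assoc]),
      ?_, ?_, rfl, eqOn_update (hs₁.trans (hs₂.mono ?_)) _ (by simp), ?_⟩
    · simp [hkeep, hx]
    · simp [hkeep]
    · exact Set.compl_subset_compl.2 ((scratch_anti (by omega)).trans (Set.subset_insert ..))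
    · simp [Finset.sum_range_succ, hkeep, hv₁, hv₂]

lemma sum (x : ℕ) (he : Correct P n m e) : Correct P n m (sum x e) := by
  intro k t ρ r hP hr
  obtain ⟨hinit, hloop⟩ := codeAt_cons.1 hP
  have hr₀ : Set.EqOn r (Function.update r (treg t) 0) (scratch t)ᶜ :=
    eqOn_update (Set.eqOn_refl ..) _ (by simp)
  obtain ⟨r', m', hR, hx, rfl, hs, hv⟩ := (he.loopInvariant_sum hr hloop).reaches_end hloop
    (r := Function.update r (treg t) 0) (m := m)
    ⟨rfl, hr₀.mono (Set.compl_subset_compl.2 (Set.subset_insert ..)), by simp⟩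
  refine ⟨r', ((reaches_exec hinit).trans hR).of_le_of_eq (by simp [cost]; grind)
    (by simp [compile, add_assoc, add_comm]), fun a ha => ?_, hv⟩
  rcases eq_or_ne a (vreg x) with rfl | hax
  · simpa using hx.symm
  · exact hs (by simpa [hax] using ha)

end Expr.Correct

theorem Expr.correct (P : Program) (n : ℕ) (m : ℕ → ℕ) (e : Expr) : e.Correct P n m := by
  induction e with
  | size => exact .size
  | var x => exact .var x
  | const v => exact .const v
  | add a b ha hb => exact ha.add hb
  | sub a b ha hb => exact ha.sub hb
  | read a ha => exact ha.read
  | ifz c a b hc ha hb => exact hc.ifz ha hb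
  | sum x e he => exact he.sum x

/-- The compiled command is correct: in `P`, and for input size `n`, it takes at most `c.cost`
steps, changes the memory as `c` does and no register that is in use. -/
def Cmd.Correct (P : Program) (n : ℕ) (c : Cmd) : Prop :=
  ∀ ⦃k t : ℕ⦄ ⦃ρ r m : ℕ → ℕ⦄, CodeAt P k (c.compile k t) → Agrees n ρ r →
    ∃ r', Reaches P (c.cost.eval n) ⟨k, r, m⟩
        ⟨k + (c.compile k t).length, r', c.eval n ρ m⟩ ∧ Set.EqOn r r' (scratch t)ᶜ

namespace Cmd.Correct

variable {P : Program} {n : ℕ} {c d : Cmd}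

lemma store (a e : Expr) : Correct P n (store a e) := by
  intro k t ρ r m hP hr
  simp only [compile, codeAt_append, codeAt_cons] at hP
  obtain ⟨⟨hPa, hPe⟩, hi, -⟩ := hP
  obtain ⟨r₁, hR, hs, hva, hve⟩ := (a.correct P n m).pair (e.correct P n m) hPa hPe hr
  have hstore := hR.trans (reaches_exec hi)
  simp only [exec, hva, hve] at hstore
  exact ⟨r₁, hstore.of_le_of_eq (by simp [cost]) (by simp [compile, add_assoc]), hs⟩

lemma seq (hc : Correct P n c) (hd : Correct P n d) : Correct P n (seq c d) := by
  intro k t ρ r m hP hr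
  obtain ⟨hPc, hPd⟩ := codeAt_append.1 hP
  obtain ⟨r₁, hR₁, hs₁⟩ := hc (m := m) hPc hr
  obtain ⟨r₂, hR₂, hs₂⟩ := hd (m := c.eval n ρ m) hPd (hr.congr hs₁)
  exact ⟨r₂, (hR₁.trans hR₂).of_le_of_eq (by simp [cost]) (by simp [compile, add_assoc]),
    hs₁.trans hs₂⟩

lemma when (e : Expr) (hc : Correct P n c) : Correct P n (when e c) := by
  intro k t ρ r m hP hr
  simp only [compile, codeAt_append, codeAt_cons] at hP
  obtain ⟨hPe, hjz, hPc⟩ := hP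
  obtain ⟨r₁, hR₁, hs₁, hv₁⟩ := e.correct P n m hPe hr
  have htest := hR₁.trans (reaches_exec hjz)
  by_cases h : e.eval n m ρ = 0
  · simp only [exec, hv₁, h, if_true] at htest
    simp only [eval, h, if_true]
    exact ⟨r₁, htest.of_le_of_eq (by simp [cost]) (by simp [compile]; omega), hs₁⟩
  · obtain ⟨r₂, hR₂, hs₂⟩ := hc (m := m) hPc (hr.congr hs₁)
    simp only [exec, hv₁, h, if_false] at htest
    simp only [eval, h, if_false]
    exact ⟨r₂, (htest.trans hR₂).of_le_of_eq (by simp [cost]; omega) (by simp [compile]; omega),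
      hs₁.trans hs₂⟩

lemma loopInvariant_loop (hc : Correct P n c) {k t x : ℕ} {ρ r m : ℕ → ℕ} (hr : Agrees n ρ r)
    (hP : CodeAt P k (loopCode k x t (c.compile (k + 5) (t + 2)))) :
    LoopInvariant P n k x t (c.cost.eval n) (c.compile (k + 5) (t + 2))
      (fun i r' m' =>
        m' = (List.range i).foldl (fun m i => c.eval n (Function.update ρ x i) m) m ∧
        Set.EqOn r r' (insert (vreg x) (scratch t))ᶜ) where
  size_eq := fun ⟨_, hs⟩ => by rw [← hs (by simp), hr.1]
  congr := fun hr' ⟨hm, hs⟩ => ⟨hm,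
    hs.trans (hr'.mono (Set.compl_subset_compl.2 (by simp [Set.insert_subset_iff])))⟩
  body := by
    rintro i r₁ m₁ - hx ⟨hm₁, hs₁⟩
    obtain ⟨-, -, -, -, hB, -⟩ := codeAt_loopCode.1 hP
    obtain ⟨r₂, hR₂, hs₂⟩ := hc (m := m₁) hB (hr.update hs₁ hx)
    refine ⟨r₂, _, hR₂, by rw [← hs₂ (by simp), hx], by rw [hs₂ (by simp)], ?_,
      hs₁.trans (hs₂.mono ?_)⟩
    · simp [List.range_succ, hm₁]
    · exact Set.compl_subset_compl.2 ((scratch_anti (by omega)).trans (Set.subset_insert ..))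

lemma loop (x : ℕ) (hc : Correct P n c) : Correct P n (loop x c) := by
  intro k t ρ r m hP hr
  obtain ⟨r', m', hR, hx, rfl, hs⟩ := (hc.loopInvariant_loop (m := m) hr hP).reaches_end hP
    (r := r) (m := m) ⟨by simp, Set.eqOn_refl ..⟩
  refine ⟨r', hR.of_le_of_eq (by simp [cost]) rfl, fun a ha => ?_⟩
  rcases eq_or_ne a (vreg x) with rfl | hax
  · exact hx.symm
  · exact hs (by simpa [hax] using ha)

end Cmd.Correct

theorem Cmd.correct (P : Program) (n : ℕ) (c : Cmd) : c.Correct P n := by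
  induction c with
  | store a e => exact .store a e
  | seq c d hc hd => exact hc.seq hd
  | when e c hc => exact hc.when e
  | loop x c hc => exact hc.loop x

/-- The program that executes `c` and outputs the value of `e`. -/
def mainProgram (c : Cmd) (e : Expr) : Program :=
  c.compile 0 0 ++ e.compile (c.compile 0 0).length 0 ++ moveCode 0 (treg 0)

lemma reaches_mainProgram (c : Cmd) (e : Expr) {n : ℕ} (G : SimpleGraph (Fin n)) :
    ∃ r' m', Reaches (mainProgram c e) ((c.cost + e.cost + 2).eval n) (input G)
        ⟨(mainProgram c e).length, r', m'⟩ ∧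
      r' 0 = e.eval n (c.eval n (fun _ => 0) (input G).mem) (fun _ => 0) := by
  obtain ⟨⟨hPc, hPe⟩, hmove⟩ : (_ ∧ _) ∧ _ := by
    simpa only [codeAt_append, mainProgram, zero_add] using codeAt_self (mainProgram c e)
  have hr : Agrees n (fun _ => 0) (input G).reg := ⟨by simp [input], by simp [input, vreg]⟩
  obtain ⟨r₁, hR₁, hs₁⟩ := c.correct _ n (m := (input G).mem) hPc hr
  rw [zero_add] at hR₁
  obtain ⟨r₂, hR₂, -, hv⟩ := e.correct _ n _ hPe (hr.congr hs₁)
  exact ⟨_, _, ((hR₁.trans hR₂).trans (reaches_moveCode (by simpa using hmove)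
    (zero_ne_treg 0).symm)).of_le_of_eq (by simp) (by simp [mainProgram, moveCode, add_assoc]),
    by simp [hv]⟩

theorem decidableInPolyTime_of_eval {Q : ∀ n : ℕ, SimpleGraph (Fin n) → Prop} (c : Cmd) (e : Expr)
    (hpos : ∀ n G, Q n G → e.eval n (c.eval n (fun _ => 0) (input G).mem) (fun _ => 0) = 1)
    (hneg : ∀ n G, ¬ Q n G → e.eval n (c.eval n (fun _ => 0) (input G).mem) (fun _ => 0) = 0) :
    DecidableInPolyTime Q := by
  refine ⟨mainProgram c e, c.cost + e.cost + 2, fun n G => ?_⟩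
  obtain ⟨r', m', ⟨t, ht, hrun⟩, hr'⟩ := reaches_mainProgram c e G
  refine ⟨t, ht, ?_, fun hQ => ?_, fun hQ => ?_⟩
  · simp [Halted, hrun]
  · simpa [hrun, hr'] using hpos n G hQ
  · simpa [hrun, hr'] using hneg n G hQ

end RAM

namespace MatchingPairs

variable {V : Type*} {G : SimpleGraph V} {F F' H M N : Finset (Sym2 V)}

/-! ### Matchings and exposed vertices -/

/-- The vertex `v` is exposed by `M` if no edge of `M` contains it. -/
def Exposed (M : Finset (Sym2 V)) (v : V) : Prop := ∀ e ∈ M, v ∉ e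

lemma Exposed.notMem_mk {a b : V} (h : Exposed M a) : s(a, b) ∉ M :=
  fun hM => h _ hM (Sym2.mem_mk_left a b)

lemma not_exposed_iff {a : V} : ¬ Exposed M a ↔ ∃ b, s(a, b) ∈ M := by
  refine ⟨fun h => ?_, fun ⟨b, hb⟩ h => h.notMem_mk hb⟩
  simp only [Exposed, not_forall, not_not] at h
  obtain ⟨_, he, b, rfl⟩ := h
  exact ⟨b, he⟩

lemma isMatching_empty (G : SimpleGraph V) : IsMatching G ∅ := by simp [IsMatching]

lemma IsMatching.eq_of_mem (h : IsMatching G M) {e f : Sym2 V} (he : e ∈ M) (hf : f ∈ M) {v : V}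
    (hve : v ∈ e) (hvf : v ∈ f) : e = f := by
  by_contra hne
  exact h.2 e he f hf hne v ⟨hve, hvf⟩

lemma IsMatching.right_unique (h : IsMatching G M) {a b c : V} (hb : s(a, b) ∈ M)
    (hc : s(a, c) ∈ M) : b = c :=
  Sym2.congr_right.1 (h.eq_of_mem hb hc (Sym2.mem_mk_left a b) (Sym2.mem_mk_left a c))

lemma IsMatching.left_unique (h : IsMatching G M) {a b c : V} (hb : s(b, a) ∈ M)
    (hc : s(c, a) ∈ M) : b = c :=
  h.right_unique (Sym2.eq_swap ▸ hb) (Sym2.eq_swap ▸ hc)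

lemma IsMatching.subset (h : IsMatching G M) (hN : N ⊆ M) : IsMatching G N :=
  ⟨fun e he => h.1 e (hN he), fun e he f hf => h.2 e (hN he) f (hN hf)⟩

lemma IsMatching.union [DecidableEq V] (hM : IsMatching G M) (hN : IsMatching G N)
    (hd : ∀ e ∈ M, ∀ v ∈ e, Exposed N v) : IsMatching G (M ∪ N) := by
  refine ⟨fun e he => (Finset.mem_union.1 he).elim (hM.1 e) (hN.1 e), ?_⟩
  rintro e he f hf hne v ⟨hve, hvf⟩
  rcases Finset.mem_union.1 he with he | he <;> rcases Finset.mem_union.1 hf with hf | hf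
  · exact hM.2 e he f hf hne v ⟨hve, hvf⟩
  · exact hd e he v hve f hf hvf
  · exact hd f hf v hvf e he hve
  · exact hN.2 e he f hf hne v ⟨hve, hvf⟩

lemma IsMatching.insert [DecidableEq V] (h : IsMatching G M) {e : Sym2 V} (he : e ∈ G.edgeSet)
    (hd : ∀ v ∈ e, Exposed M v) : IsMatching G (insert e M) := by
  rw [Finset.insert_eq]
  have hsingle : IsMatching G {e} := ⟨by simpa, by simp +contextual⟩
  exact hsingle.union h (by simpa)

lemma IsMatching.exposed_erase [DecidableEq V] (hM : IsMatching G M) {e : Sym2 V} (he : e ∈ M)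
    {v : V} (hv : v ∈ e) : Exposed (M.erase e) v := fun _ hf hvf =>
  (Finset.mem_erase.1 hf).1 (hM.eq_of_mem (Finset.mem_of_mem_erase hf) he hvf hv)

lemma notMem_of_exposed {e : Sym2 V} (h : ∀ v ∈ e, Exposed M v) : e ∉ M := by
  induction e with | _ a b
  exact (h a (Sym2.mem_mk_left a b)).notMem_mk

lemma isMatching_deleteEdges :
    IsMatching (G.deleteEdges F) M ↔ IsMatching G M ∧ Disjoint M F := by
  simp only [IsMatching, SimpleGraph.edgeSet_deleteEdges, Set.mem_sdiff, Finset.mem_coe,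
    Finset.disjoint_left]
  grind

/-! ### Matching numbers -/

section Finite

variable [Finite V]

lemma bddAbove_matchings (G : SimpleGraph V) :
    BddAbove {k : ℕ | ∃ M : Finset (Sym2 V), IsMatching G M ∧ M.card = k} := by
  have := Fintype.ofFinite (Sym2 V)
  exact ⟨Fintype.card (Sym2 V), by rintro k ⟨M, -, rfl⟩; exact Finset.card_le_univ M⟩

lemma IsMatching.card_le (h : IsMatching G M) : M.card ≤ matchingNumber G :=
  le_csSup (bddAbove_matchings G) ⟨M, h, rfl⟩

lemma IsMatching.card_le_deleteEdges (h : IsMatching G M) (hd : Disjoint M F) :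
    M.card ≤ matchingNumber (G.deleteEdges F) :=
  (isMatching_deleteEdges.2 ⟨h, hd⟩).card_le

lemma exists_isMaximumMatching (G : SimpleGraph V) : ∃ M, IsMaximumMatching G M :=
  Nat.sSup_mem (s := {k : ℕ | ∃ M : Finset (Sym2 V), IsMatching G M ∧ M.card = k})
    ⟨0, ∅, isMatching_empty G, rfl⟩ (bddAbove_matchings G)

lemma matchingNumber_le {k : ℕ} (h : ∀ M, IsMatching G M → M.card ≤ k) :
    matchingNumber G ≤ k := by
  obtain ⟨M, hM, hc⟩ := exists_isMaximumMatching G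
  exact hc ▸ h M hM

lemma residualMatchingNumbers_nonempty (G : SimpleGraph V) :
    (residualMatchingNumbers G).Nonempty :=
  have ⟨M, hM⟩ := exists_isMaximumMatching G
  ⟨_, M, hM, rfl⟩

lemma bddAbove_residualMatchingNumbers (G : SimpleGraph V) :
    BddAbove (residualMatchingNumbers G) := by
  refine ⟨matchingNumber G, ?_⟩
  rintro k ⟨F, -, rfl⟩
  exact matchingNumber_le fun M hM => (isMatching_deleteEdges.1 hM).1.card_le

lemma exists_matchingNumber_deleteEdges_eq_bigL (G : SimpleGraph V) :
    ∃ F, IsMaximumMatching G F ∧ matchingNumber (G.deleteEdges F) = bigL G :=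
  Nat.sSup_mem (residualMatchingNumbers_nonempty G) (bddAbove_residualMatchingNumbers G)

lemma exists_matchingNumber_deleteEdges_eq_smallL (G : SimpleGraph V) :
    ∃ F, IsMaximumMatching G F ∧ matchingNumber (G.deleteEdges F) = smallL G :=
  Nat.sInf_mem (residualMatchingNumbers_nonempty G)

lemma IsMaximumMatching.le_bigL (hF : IsMaximumMatching G F) :
    matchingNumber (G.deleteEdges F) ≤ bigL G :=
  le_csSup (bddAbove_residualMatchingNumbers G) ⟨F, hF, rfl⟩

end Finite

lemma IsMaximumMatching.smallL_le (hF : IsMaximumMatching G F) :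
    smallL G ≤ matchingNumber (G.deleteEdges F) :=
  Nat.sInf_le ⟨F, hF, rfl⟩

/-! ### Maximum matchings have no augmenting paths of length one or three -/

lemma IsMaximumMatching.exchange [DecidableEq V] (hF : IsMaximumMatching G F) {v a b : V}
    (hv : Exposed F v) (hab : s(a, b) ∈ F) (hva : G.Adj v a) :
    IsMaximumMatching G (insert s(v, a) (F.erase s(a, b))) := by
  have hexp : ∀ x ∈ s(v, a), Exposed (F.erase s(a, b)) x := fun x hx => by
    rcases Sym2.mem_iff.1 hx with rfl | rfl
    · exact fun e he => hv e (Finset.mem_of_mem_erase he)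
    · exact hF.1.exposed_erase hab (Sym2.mem_mk_left x b)
  refine ⟨(hF.1.subset (Finset.erase_subset _ _)).insert hva hexp, ?_⟩
  rw [Finset.card_insert_of_notMem (notMem_of_exposed hexp), Finset.card_erase_add_one hab, hF.2]

section Augmenting

variable [Finite V]

lemma IsMaximumMatching.exists_mem_not_exposed (hF : IsMaximumMatching G F) {e : Sym2 V}
    (he : e ∈ G.edgeSet) : ∃ v ∈ e, ¬ Exposed F v := by
  classical
  by_contra! hexp
  have hcard := (hF.1.insert he hexp).card_le
  rw [Finset.card_insert_of_notMem (notMem_of_exposed hexp), hF.2] at hcard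
  omega

lemma IsMaximumMatching.exists_partner (hF : IsMaximumMatching G F) {v a : V}
    (hv : Exposed F v) (h : G.Adj v a) : ∃ b, s(a, b) ∈ F := by
  obtain ⟨x, hx, hxF⟩ := hF.exists_mem_not_exposed (e := s(v, a)) h
  rcases Sym2.mem_iff.1 hx with rfl | rfl
  · exact absurd hv hxF
  · exact not_exposed_iff.1 hxF

lemma IsMaximumMatching.eq_of_adj_adj (hF : IsMaximumMatching G F) {v w a b : V}
    (hv : Exposed F v) (hw : Exposed F w) (hab : s(a, b) ∈ F) (hva : G.Adj v a)
    (hwb : G.Adj w b) : v = w := by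
  classical
  obtain ⟨x, hx, hxF⟩ :=
    (hF.exchange hv hab hva).exists_mem_not_exposed (e := s(w, b)) hwb
  obtain ⟨y, hy⟩ := not_exposed_iff.1 hxF
  have hne : a ≠ b := (show G.Adj a b from hF.1.1 _ hab).ne
  have hva' := hv _ hab
  have hwa' := hw _ hab
  simp only [Sym2.mem_iff, not_or] at hx hva' hwa'
  rcases Finset.mem_insert.1 hy with hy | hy
  · have : x = v ∨ x = a := Sym2.mem_iff.1 (hy ▸ Sym2.mem_mk_left x y)
    grind
  · rcases hx with rfl | rfl
    · exact absurd (Finset.mem_of_mem_erase hy) hw.notMem_mk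
    · exact absurd hy (hF.1.exposed_erase hab (Sym2.mem_mk_right a x)).notMem_mk

end Augmenting

/-! ### The inequality `L ≤ 2 l` and its equality case -/

lemma inter_subset_sdiff_of_disjoint [DecidableEq V] (h : Disjoint H F') : H ∩ F ⊆ F \ F' :=
  fun _ he => Finset.mem_sdiff.2
    ⟨(Finset.mem_inter.1 he).2, Finset.disjoint_left.1 h (Finset.mem_inter.1 he).1⟩

lemma IsMaximumMatching.card_sdiff_comm [DecidableEq V] (hF : IsMaximumMatching G F)
    (hF' : IsMaximumMatching G F') : (F \ F').card = (F' \ F).card :=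
  Finset.card_sdiff_comm (hF.2.trans hF'.2.symm)

/-- The equality case of `IsMatching.card_le_two_mul`. -/
structure ExtremalTriple (G : SimpleGraph V) (F F' H : Finset (Sym2 V)) : Prop where
  isMaximum : IsMaximumMatching G F
  isMaximum' : IsMaximumMatching G F'
  isMatching : IsMatching G H
  disjoint : Disjoint H F'
  le_card : 2 * matchingNumber (G.deleteEdges F) ≤ H.card

/-- The edge `vu` belongs to `F' \ F`, the edge `vw` to `H \ F`, and `u` lies on an edge of
`F \ F'`. In an extremal triple, the vertices `v` occurring here are the exposed vertices from
which the edges of `F` are doubly reached. -/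
structure Fork (F F' H : Finset (Sym2 V)) (v u w : V) : Prop where
  left_mem : s(v, u) ∈ F'
  left_notMem : s(v, u) ∉ F
  right_mem : s(v, w) ∈ H
  right_notMem : s(v, w) ∉ F
  matched : ∃ a ∈ F, a ∉ F' ∧ u ∈ a

lemma ExtremalTriple.adj_left (h : ExtremalTriple G F F' H) {v u w : V}
    (hv : Fork F F' H v u w) : G.Adj v u :=
  h.isMaximum'.1.1 _ hv.left_mem

lemma ExtremalTriple.adj_right (h : ExtremalTriple G F F' H) {v u w : V}
    (hv : Fork F F' H v u w) : G.Adj v w :=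
  h.isMatching.1 _ hv.right_mem

section Extremal

variable [Finite V]

lemma IsMatching.card_sdiff_le [DecidableEq V] (hM : IsMatching G M) (F : Finset (Sym2 V)) :
    (M \ F).card ≤ matchingNumber (G.deleteEdges F) :=
  (hM.subset Finset.sdiff_subset).card_le_deleteEdges Finset.sdiff_disjoint

lemma IsMatching.card_le_two_mul (hH : IsMatching G H) (hd : Disjoint H F')
    (hF : IsMaximumMatching G F) (hF' : IsMaximumMatching G F') :
    H.card ≤ 2 * matchingNumber (G.deleteEdges F) := by
  classical
  have hinter := calc
    (H ∩ F).card ≤ (F \ F').card := Finset.card_le_card (inter_subset_sdiff_of_disjoint hd)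
    _ = (F' \ F).card := hF.card_sdiff_comm hF'
    _ ≤ matchingNumber (G.deleteEdges F) := hF'.1.card_sdiff_le F
  have hsdiff := hH.card_sdiff_le F
  have hsum := Finset.card_inter_add_card_sdiff H F
  omega

theorem bigL_le_two_mul_smallL (G : SimpleGraph V) : bigL G ≤ 2 * smallL G := by
  obtain ⟨F', hF', hL⟩ := exists_matchingNumber_deleteEdges_eq_bigL G
  obtain ⟨F, hF, hl⟩ := exists_matchingNumber_deleteEdges_eq_smallL G
  rw [← hL, ← hl]
  exact matchingNumber_le fun M hM =>
    (isMatching_deleteEdges.1 hM).1.card_le_two_mul (isMatching_deleteEdges.1 hM).2 hF hF'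

lemma ExtremalTriple.of_bigL_eq (h : bigL G = 2 * smallL G) :
    ∃ F F' H, ExtremalTriple G F F' H := by
  obtain ⟨F', hF', hL⟩ := exists_matchingNumber_deleteEdges_eq_bigL G
  obtain ⟨F, hF, hl⟩ := exists_matchingNumber_deleteEdges_eq_smallL G
  obtain ⟨H, hH, hcard⟩ := exists_isMaximumMatching (G.deleteEdges F')
  obtain ⟨hH, hd⟩ := isMatching_deleteEdges.1 hH
  exact ⟨F, F', H, hF, hF', hH, hd, by omega⟩

namespace ExtremalTriple

lemma inter_eq_and_card_eq [DecidableEq V] (h : ExtremalTriple G F F' H) :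
    H ∩ F = F \ F' ∧ (F' \ F).card = matchingNumber (G.deleteEdges F) ∧
      (H \ F).card = matchingNumber (G.deleteEdges F) := by
  have hsub := inter_subset_sdiff_of_disjoint (F := F) h.disjoint
  have hinter := Finset.card_le_card hsub
  have hcomm := h.isMaximum.card_sdiff_comm h.isMaximum'
  have hF' := h.isMaximum'.1.card_sdiff_le F
  have hH := h.isMatching.card_sdiff_le F
  have hsum := Finset.card_inter_add_card_sdiff H F
  have hle := h.le_card
  exact ⟨Finset.eq_of_subset_of_card_le hsub (by omega), by omega, by omega⟩

lemma mem_of_mem_of_notMem (h : ExtremalTriple G F F' H) {e : Sym2 V} (he : e ∈ F)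
    (he' : e ∉ F') : e ∈ H := by
  classical
  have : e ∈ H ∩ F := h.inter_eq_and_card_eq.1 ▸ Finset.mem_sdiff.2 ⟨he, he'⟩
  exact (Finset.mem_inter.1 this).1

lemma notMem_of_mem (h : ExtremalTriple G F F' H) {a c : Sym2 V} (ha : a ∈ F) (ha' : a ∉ F')
    (hc : c ∈ H) (hc' : c ∉ F) {v : V} (hva : v ∈ a) : v ∉ c := fun hvc =>
  hc' (h.isMatching.eq_of_mem (h.mem_of_mem_of_notMem ha ha') hc hva hvc ▸ ha)

lemma exists_mem_meets_sdiff (h : ExtremalTriple G F F' H) {b : Sym2 V} (hb : b ∈ F')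
    (hb' : b ∉ F) : ∃ u ∈ b, ∃ a ∈ F, a ∉ F' ∧ u ∈ a := by
  obtain ⟨u, hu, hexp⟩ := h.isMaximum.exists_mem_not_exposed (h.isMaximum'.1.1 b hb)
  obtain ⟨x, hx⟩ := not_exposed_iff.1 hexp
  refine ⟨u, hu, _, hx, fun hx' => hb' ?_, Sym2.mem_mk_left u x⟩
  rwa [h.isMaximum'.1.eq_of_mem hb hx' hu (Sym2.mem_mk_left u x)]

lemma exists_mem_meets (h : ExtremalTriple G F F' H) {c : Sym2 V} (hc : c ∈ H) (hc' : c ∉ F) :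
    ∃ v ∈ c, ∃ u, s(v, u) ∈ F' ∧ s(v, u) ∉ F := by
  classical
  suffices ∃ v ∈ c, ¬ Exposed (F' \ F) v by
    obtain ⟨v, hv, hexp⟩ := this
    exact ⟨v, hv, by simpa only [Finset.mem_sdiff] using not_exposed_iff.1 hexp⟩
  by_contra! hexp
  have hle := ((h.isMaximum'.1.subset Finset.sdiff_subset).insert
    (h.isMatching.1 c hc) hexp).card_le_deleteEdges
      (Finset.disjoint_insert_left.2 ⟨hc', Finset.sdiff_disjoint⟩)
  rw [Finset.card_insert_of_notMem (notMem_of_exposed hexp), h.inter_eq_and_card_eq.2.1] at hle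
  omega

lemma exists_fork (h : ExtremalTriple G F F' H) {c : Sym2 V} (hc : c ∈ H) (hc' : c ∉ F) :
    ∃ v ∈ c, ∃ u w, Fork F F' H v u w := by
  obtain ⟨v, hvc, u, hvu, hvu'⟩ := h.exists_mem_meets hc hc'
  obtain ⟨x, hx, a, ha, ha', hxa⟩ := h.exists_mem_meets_sdiff hvu hvu'
  obtain rfl : x = u := (Sym2.mem_iff.1 hx).resolve_left fun hxv =>
    h.notMem_of_mem ha ha' hc hc' hxa (hxv ▸ hvc)
  obtain ⟨w, rfl⟩ := hvc
  exact ⟨v, Sym2.mem_mk_left v w, x, w, hvu, hvu', hc, hc', a, ha, ha', hxa⟩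

variable {v u w v' u' w' : V}

lemma exposed_of_fork (h : ExtremalTriple G F F' H) (hv : Fork F F' H v u w) : Exposed F v := by
  intro e he hve
  by_cases he' : e ∈ F'
  · have := h.isMaximum'.1.eq_of_mem he' hv.left_mem hve (Sym2.mem_mk_left v u)
    exact hv.left_notMem (this ▸ he)
  · exact h.notMem_of_mem he he' hv.right_mem hv.right_notMem hve (Sym2.mem_mk_left v w)

lemma eq_of_mem_left (h : ExtremalTriple G F F' H) (hv : Fork F F' H v u w)
    (hv' : Fork F F' H v' u' w') {e : Sym2 V} (he : e ∈ F) (hu : u ∈ e) (hu' : u' ∈ e) :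
    v = v' := by
  by_cases huu' : u = u'
  · subst huu'
    exact h.isMaximum'.1.left_unique hv.left_mem hv'.left_mem
  · rw [(Sym2.mem_and_mem_iff huu').1 ⟨hu, hu'⟩] at he
    exact h.isMaximum.eq_of_adj_adj (h.exposed_of_fork hv) (h.exposed_of_fork hv') he
      (h.adj_left hv) (h.adj_left hv')

lemma eq_of_mem_right (h : ExtremalTriple G F F' H) (hv : Fork F F' H v u w)
    (hv' : Fork F F' H v' u' w') {e : Sym2 V} (he : e ∈ F) (hw : w ∈ e) (hw' : w' ∈ e) :
    v = v' := by
  by_cases hww' : w = w'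
  · subst hww'
    exact h.isMatching.left_unique hv.right_mem hv'.right_mem
  · rw [(Sym2.mem_and_mem_iff hww').1 ⟨hw, hw'⟩] at he
    exact h.isMaximum.eq_of_adj_adj (h.exposed_of_fork hv) (h.exposed_of_fork hv') he
      (h.adj_right hv) (h.adj_right hv')

lemma notMem_right_of_mem_left (h : ExtremalTriple G F F' H) (hv : Fork F F' H v u w)
    (hv' : Fork F F' H v' u' w') {e : Sym2 V} (he : e ∈ F) (hu : u ∈ e) : w' ∉ e := by
  obtain ⟨a, ha, ha', hua⟩ := hv.matched
  obtain rfl := h.isMaximum.1.eq_of_mem ha he hua hu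
  exact fun hw' => h.notMem_of_mem ha ha' hv'.right_mem hv'.right_notMem hw'
    (Sym2.mem_mk_right v' w')

lemma card_le_of_forall_fork (h : ExtremalTriple G F F' H) {Y : Finset V}
    (hY : ∀ v u w, Fork F F' H v u w → v ∈ Y) :
    matchingNumber (G.deleteEdges F) ≤ Y.card := by
  classical
  rw [← h.inter_eq_and_card_eq.2.2]
  refine Finset.card_le_card_of_forall_subsingleton (fun c v => v ∈ c) (fun c hc => ?_) ?_
  · obtain ⟨v, hv, u, w, hfork⟩ :=
      h.exists_fork (Finset.mem_sdiff.1 hc).1 (Finset.mem_sdiff.1 hc).2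
    exact ⟨v, hY v u w hfork, hv⟩
  · rintro v - c ⟨hc, hvc⟩ c' ⟨hc', hvc'⟩
    exact h.isMatching.eq_of_mem (Finset.mem_sdiff.1 hc).1 (Finset.mem_sdiff.1 hc').1 hvc hvc'

end ExtremalTriple

/-- `F` is a maximum matching that exposes the vertices of `Y`, and each `v` in `Y` has two
neighbours `s v b` such that the edges of `F` at all these neighbours are distinct. -/
structure DoubleSystem (G : SimpleGraph V) (F : Finset (Sym2 V)) (Y : Finset V)
    (s : V → Bool → V) : Prop where
  isMaximum : IsMaximumMatching G F
  exposed : ∀ v ∈ Y, Exposed F v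
  adj : ∀ v ∈ Y, ∀ b, G.Adj v (s v b)
  distinct : ∀ v ∈ Y, ∀ w ∈ Y, ∀ b c, ∀ e ∈ F, s v b ∈ e → s w c ∈ e → v = w ∧ b = c

/-- A double system whose set `Y` is as large as the matching number of `G \ F` allows; these
systems certify that `L(G) = 2 l(G)`. -/
structure Extremal (G : SimpleGraph V) (F : Finset (Sym2 V)) (Y : Finset V) (s : V → Bool → V) :
    Prop extends DoubleSystem G F Y s where
  card_le : matchingNumber (G.deleteEdges F) ≤ Y.card

lemma ExtremalTriple.exists_extremal (h : ExtremalTriple G F F' H) : ∃ Y s, Extremal G F Y s := by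
  classical
  have := Fintype.ofFinite V
  let Y : Finset V := Finset.univ.filter fun v => ∃ u w, Fork F F' H v u w
  have hY : ∀ v ∈ Y, ∃ u w, Fork F F' H v u w := fun v hv => (Finset.mem_filter.1 hv).2
  choose! u w huw using hY
  refine ⟨Y, fun v b => if b then u v else w v,
    ⟨h.isMaximum, fun v hv => h.exposed_of_fork (huw v hv), fun v hv b => ?_, ?_⟩,
    h.card_le_of_forall_fork fun v u w hv => Finset.mem_filter.2 ⟨Finset.mem_univ v, u, w, hv⟩⟩
  · cases b
    · exact h.adj_right (huw v hv)
    · exact h.adj_left (huw v hv)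
  · rintro v hv v' hv' (_ | _) (_ | _) e he hs hs'
    · exact ⟨h.eq_of_mem_right (huw v hv) (huw v' hv') he hs hs', rfl⟩
    · exact absurd hs (h.notMem_right_of_mem_left (huw v' hv') (huw v hv) he hs')
    · exact absurd hs' (h.notMem_right_of_mem_left (huw v hv) (huw v' hv') he hs)
    · exact ⟨h.eq_of_mem_left (huw v hv) (huw v' hv') he hs hs', rfl⟩

end Extremal

end MatchingPairs

namespace MatchingPairs

variable {V : Type*} {G : SimpleGraph V} {F : Finset (Sym2 V)} {Y : Finset V}
  {s : V → Bool → V}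

/-! ### Double systems bound `L` from below -/

/-- The edges `v (f v)`, for `v` in `Y`. -/
def starEdges [DecidableEq V] (Y : Finset V) (f : V → V) : Finset (Sym2 V) :=
  Y.image fun v => s(v, f v)

section Star

variable [DecidableEq V] {f : V → V}

lemma mem_starEdges {e : Sym2 V} : e ∈ starEdges Y f ↔ ∃ v ∈ Y, s(v, f v) = e := by
  simp [starEdges]

lemma card_starEdges (hf : ∀ v ∈ Y, f v ∉ Y) : (starEdges Y f).card = Y.card := by
  refine Finset.card_image_of_injOn fun v hv w hw h => ?_
  rcases Sym2.eq_iff.1 h with h | h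
  · exact h.1
  · exact absurd (h.1 ▸ hv) (hf w hw)

lemma isMatching_starEdges (hG : ∀ v ∈ Y, G.Adj v (f v)) (hf : ∀ v ∈ Y, f v ∉ Y)
    (hi : ∀ v ∈ Y, ∀ w ∈ Y, f v = f w → v = w) : IsMatching G (starEdges Y f) := by
  simp only [IsMatching, mem_starEdges]
  refine ⟨fun e ⟨v, hv, he⟩ => he ▸ hG v hv, ?_⟩
  rintro _ ⟨v, hv, rfl⟩ _ ⟨w, hw, rfl⟩ hne x ⟨hxv, hxw⟩
  rw [Sym2.mem_iff] at hxv hxw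
  have hfv := hf v hv
  have hfw := hf w hw
  have hvw := hi v hv w hw
  grind

lemma exposed_starEdges {x : V} (hx : x ∉ Y) (hfx : ∀ v ∈ Y, x ≠ f v) :
    Exposed (starEdges Y f) x := by
  intro e he
  obtain ⟨v, hv, rfl⟩ := mem_starEdges.1 he
  rw [Sym2.mem_iff, not_or]
  exact ⟨fun h => hx (h ▸ hv), hfx v hv⟩

lemma disjoint_starEdges (hY : ∀ v ∈ Y, Exposed F v) : Disjoint (starEdges Y f) F := by
  rw [Finset.disjoint_left]
  intro e he
  obtain ⟨v, hv, rfl⟩ := mem_starEdges.1 he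
  exact (hY v hv).notMem_mk

end Star

namespace DoubleSystem

section Finite

variable [Finite V]

lemma notMem_of_adj (h : DoubleSystem G F Y s) {v a : V} (hv : v ∈ Y) (hva : G.Adj v a) :
    a ∉ Y := fun ha =>
  have ⟨_, hb⟩ := h.isMaximum.exists_partner (h.exposed v hv) hva
  (h.exposed a ha).notMem_mk hb

lemma exists_partner (h : DoubleSystem G F Y s) {v : V} (hv : v ∈ Y) (b : Bool) :
    ∃ p, s(s v b, p) ∈ F :=
  h.isMaximum.exists_partner (h.exposed v hv) (h.adj v hv b)

lemma injective (h : DoubleSystem G F Y s) {v w : V} (hv : v ∈ Y) (hw : w ∈ Y) {b c : Bool}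
    (e : s v b = s w c) : v = w ∧ b = c := by
  obtain ⟨p, hp⟩ := h.exists_partner hv b
  exact h.distinct v hv w hw b c _ hp (Sym2.mem_mk_left _ p) (e ▸ Sym2.mem_mk_left _ p)

lemma isMatching_starEdges [DecidableEq V] (h : DoubleSystem G F Y s) (b : Bool) :
    IsMatching G (starEdges Y (s · b)) :=
  MatchingPairs.isMatching_starEdges (fun v hv => h.adj v hv b)
    (fun v hv => h.notMem_of_adj hv (h.adj v hv b)) fun _ hv _ hw e => (h.injective hv hw e).1

lemma card_starEdges [DecidableEq V] (h : DoubleSystem G F Y s) (b : Bool) :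
    (starEdges Y (s · b)).card = Y.card :=
  MatchingPairs.card_starEdges fun v hv => h.notMem_of_adj hv (h.adj v hv b)

lemma disjoint_starEdges_starEdges [DecidableEq V] (h : DoubleSystem G F Y s) {b c : Bool}
    (hbc : b ≠ c) : Disjoint (starEdges Y (s · b)) (starEdges Y (s · c)) := by
  rw [Finset.disjoint_left]
  intro e he he'
  obtain ⟨v, hv, rfl⟩ := mem_starEdges.1 he
  obtain ⟨w, hw, e⟩ := mem_starEdges.1 he'
  rcases Sym2.eq_iff.1 e with ⟨-, e⟩ | ⟨rfl, -⟩
  · exact hbc (h.injective hw hv e).2.symm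
  · exact h.notMem_of_adj hv (h.adj v hv b) hw

end Finite

lemma exposed_starEdges [DecidableEq V] (h : DoubleSystem G F Y s) {b : Bool} {e : Sym2 V}
    (he : e ∈ F) (hs : ∀ v ∈ Y, s v b ∉ e) : ∀ x ∈ e, Exposed (starEdges Y (s · b)) x :=
  fun _ hx => MatchingPairs.exposed_starEdges (fun hxY => h.exposed _ hxY e he hx)
    fun v hv hxv => hs v hv (hxv ▸ hx)

open Classical in
/-- The edges of `F` at the vertices `s v b`, for `v` in `Y`. -/
noncomputable def hitEdges (F : Finset (Sym2 V)) (Y : Finset V) (s : V → Bool → V) (b : Bool) :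
    Finset (Sym2 V) :=
  F.filter fun e => ∃ v ∈ Y, s v b ∈ e

lemma mem_hitEdges {b : Bool} {e : Sym2 V} :
    e ∈ hitEdges F Y s b ↔ e ∈ F ∧ ∃ v ∈ Y, s v b ∈ e := by
  simp [hitEdges]

lemma hitEdges_subset (b : Bool) : hitEdges F Y s b ⊆ F := fun _ he => (mem_hitEdges.1 he).1

variable [Finite V]

lemma card_hitEdges (h : DoubleSystem G F Y s) (b : Bool) :
    (hitEdges F Y s b).card = Y.card := by
  choose! p hp using fun v (hv : v ∈ Y) => h.exists_partner hv b
  symm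
  refine Finset.card_nbij (fun v => s(s v b, p v))
    (fun v hv => mem_hitEdges.2 ⟨hp v hv, v, hv, Sym2.mem_mk_left _ _⟩) ?_ ?_
  · intro v hv w hw (e : s(s v b, p v) = s(s w b, p w))
    exact (h.distinct v hv w hw b b _ (hp v hv) (Sym2.mem_mk_left _ _)
      (e ▸ Sym2.mem_mk_left _ _)).1
  · intro e he
    obtain ⟨he, v, hv, hve⟩ := mem_hitEdges.1 he
    exact ⟨v, hv, h.isMaximum.1.eq_of_mem (hp v hv) he (Sym2.mem_mk_left _ _) hve⟩

lemma isMaximumMatching_exchange [DecidableEq V] (h : DoubleSystem G F Y s) (b : Bool) :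
    IsMaximumMatching G (F \ hitEdges F Y s b ∪ starEdges Y (s · b)) := by
  refine ⟨(h.isMaximum.1.subset Finset.sdiff_subset).union (h.isMatching_starEdges b) ?_, ?_⟩
  · intro e he
    obtain ⟨he, hhit⟩ := Finset.mem_sdiff.1 he
    exact h.exposed_starEdges he fun v hv hve => hhit (mem_hitEdges.2 ⟨he, v, hv, hve⟩)
  · rw [Finset.card_union_of_disjoint
      ((disjoint_starEdges h.exposed).mono_right Finset.sdiff_subset).symm,
      h.card_starEdges, ← h.card_hitEdges b,
      Finset.card_sdiff_add_card_eq_card (hitEdges_subset b), h.isMaximum.2]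

lemma isMatching_hitEdges_union [DecidableEq V] (h : DoubleSystem G F Y s) {b c : Bool}
    (hbc : b ≠ c) :
    IsMatching G (hitEdges F Y s b ∪ starEdges Y (s · c)) := by
  refine (h.isMaximum.1.subset (hitEdges_subset b)).union (h.isMatching_starEdges c) ?_
  intro e he
  obtain ⟨he, v, hv, hve⟩ := mem_hitEdges.1 he
  exact h.exposed_starEdges he fun w hw hwe => hbc (h.distinct v hv w hw b c e he hve hwe).2

theorem two_mul_card_le_bigL (h : DoubleSystem G F Y s) : 2 * Y.card ≤ bigL G := by
  classical
  have hstar : ∀ c, Disjoint (starEdges Y (s · c)) F := fun _ => disjoint_starEdges h.exposed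
  have hhit := hitEdges_subset (F := F) (Y := Y) (s := s) true
  have hdisj : Disjoint (hitEdges F Y s true ∪ starEdges Y (s · false))
      (F \ hitEdges F Y s true ∪ starEdges Y (s · true)) := by
    simp only [Finset.disjoint_union_left, Finset.disjoint_union_right]
    exact ⟨⟨Finset.disjoint_sdiff, (hstar false).mono_right Finset.sdiff_subset⟩,
      (hstar true).symm.mono_left hhit, h.disjoint_starEdges_starEdges Bool.false_ne_true⟩
  calc 2 * Y.card = (hitEdges F Y s true ∪ starEdges Y (s · false)).card := by
        rw [Finset.card_union_of_disjoint ((hstar false).symm.mono_left hhit), h.card_hitEdges,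
          h.card_starEdges, two_mul]
    _ ≤ matchingNumber (G.deleteEdges (F \ hitEdges F Y s true ∪ starEdges Y (s · true) :
          Finset (Sym2 V))) :=
        (h.isMatching_hitEdges_union Bool.false_ne_true.symm).card_le_deleteEdges hdisj
    _ ≤ bigL G := (h.isMaximumMatching_exchange true).le_bigL

end DoubleSystem

theorem bigL_eq_two_mul_smallL_iff_exists_extremal [Finite V] :
    bigL G = 2 * smallL G ↔ ∃ F Y s, Extremal G F Y s := by
  constructor
  · intro h
    obtain ⟨F, F', H, htriple⟩ := ExtremalTriple.of_bigL_eq h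
    exact ⟨F, htriple.exists_extremal⟩
  · rintro ⟨F, Y, s, h⟩
    refine (bigL_le_two_mul_smallL G).antisymm ?_
    calc 2 * smallL G ≤ 2 * Y.card :=
          Nat.mul_le_mul_left 2 (h.isMaximum.smallL_le.trans h.card_le)
      _ ≤ bigL G := h.two_mul_card_le_bigL

end MatchingPairs

namespace MatchingPairs

variable {V : Type*} {G : SimpleGraph V}

/-! ### Tight edges -/

section Defs

variable (G)

/-- An edge `ab` such that `a` or `b` has degree one, or `a` and `b` have degree two and a common
neighbour. If `L(G) = 2 l(G)`, the tight edges form the maximum matching `F` of `G` for which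
`ν(G \ F)` is smallest. -/
def Tight (a b : V) : Prop :=
  G.Adj a b ∧ ((∀ x, G.Adj a x → x = b) ∨ (∀ x, G.Adj b x → x = a) ∨
    ∃ c, G.Adj a c ∧ G.Adj b c ∧ (∀ x, G.Adj a x → x = b ∨ x = c) ∧
      ∀ x, G.Adj b x → x = a ∨ x = c)

/-- The vertex `a` lies on a tight edge. -/
def Covered (a : V) : Prop := ∃ b, Tight G a b

/-- The vertex `v` has a neighbour, but lies on no tight edge. -/
def Free (v : V) : Prop := (∃ x, G.Adj v x) ∧ ¬ Covered G v

/-- The local part of the characterization of the graphs with `L = 2 l`: the tight edges form a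
matching that meets every edge, and every other edge between two covered vertices is the base of a
triangle whose apex is a free vertex of degree two. -/
structure LocallyGood : Prop where
  unique : ∀ a b c, Tight G a b → Tight G a c → b = c
  cover : ∀ a b, G.Adj a b → Covered G a ∨ Covered G b
  apex : ∀ a b, G.Adj a b → ¬ Tight G a b → Covered G a → Covered G b →
    ∃ v, Free G v ∧ G.Adj v a ∧ G.Adj v b ∧ ∀ x, G.Adj v x → x = a ∨ x = b

/-- The global part of the characterization: each free vertex `v` can be given two neighbours
`s v b` such that the tight edges at all these neighbours are distinct. -/
def HasSystem : Prop :=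
  ∃ s : V → Bool → V, (∀ v b, Free G v → G.Adj v (s v b)) ∧
    ∀ v b w c, Free G v → Free G w → (s v b = s w c ∨ Tight G (s v b) (s w c)) → v = w ∧ b = c

end Defs

lemma Tight.symm {a b : V} (h : Tight G a b) : Tight G b a := by
  obtain ⟨h, h1 | h1 | ⟨c, h1, h2, h3, h4⟩⟩ := h
  · exact ⟨h.symm, Or.inr (Or.inl h1)⟩
  · exact ⟨h.symm, Or.inl h1⟩
  · exact ⟨h.symm, Or.inr (Or.inr ⟨c, h2, h1, h4, h3⟩)⟩

lemma mem_of_mem_edgeSet_of_mem {a b : V} (ha : ∀ x, G.Adj a x → x = b) {e : Sym2 V}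
    (he : e ∈ G.edgeSet) (hae : a ∈ e) : b ∈ e := by
  obtain ⟨x, rfl⟩ := hae
  exact ha x he ▸ Sym2.mem_mk_right a x

lemma Tight.exists_common {a b : V} (h : Tight G a b) {e f : Sym2 V} (he : e ∈ G.edgeSet)
    (hf : f ∈ G.edgeSet) (hae : a ∈ e ∨ b ∈ e) (haf : a ∈ f ∨ b ∈ f) : ∃ v, v ∈ e ∧ v ∈ f := by
  obtain ⟨-, ha | hb | ⟨c, -, -, ha, hb⟩⟩ := h
  · exact ⟨b, hae.elim (mem_of_mem_edgeSet_of_mem ha he) id,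
      haf.elim (mem_of_mem_edgeSet_of_mem ha hf) id⟩
  · exact ⟨a, hae.elim id (mem_of_mem_edgeSet_of_mem hb he),
      haf.elim id (mem_of_mem_edgeSet_of_mem hb hf)⟩
  · -- both edges join two of the three vertices `a`, `b`, `c`
    have htriangle : ∀ g ∈ G.edgeSet, a ∈ g ∨ b ∈ g →
        a ∈ g ∧ b ∈ g ∨ a ∈ g ∧ c ∈ g ∨ b ∈ g ∧ c ∈ g := by
      rintro g hg (⟨x, rfl⟩ | ⟨x, rfl⟩)
      · rcases ha x hg with rfl | rfl <;> simp
      · rcases hb x hg with rfl | rfl <;> simp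
    have := htriangle e he hae
    have := htriangle f hf haf
    tauto

lemma tight_symm (G : SimpleGraph V) : Std.Symm (Tight G) := ⟨fun _ _ => Tight.symm⟩

lemma LocallyGood.exists_free_of_adj (h : LocallyGood G) {a b : V} (hab : G.Adj a b)
    (ht : ¬ Tight G a b) : ∃ v, Free G v ∧ (v ∈ s(a, b) ∨ ∀ x, G.Adj v x → x ∈ s(a, b)) := by
  by_cases ha : Covered G a
  · by_cases hb : Covered G b
    · obtain ⟨v, hv, -, -, hx⟩ := h.apex a b hab ht ha hb
      exact ⟨v, hv, Or.inr fun x hvx => Sym2.mem_iff.2 (hx x hvx)⟩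
    · exact ⟨b, ⟨⟨a, hab.symm⟩, hb⟩, Or.inl (Sym2.mem_mk_right a b)⟩
  · exact ⟨a, ⟨⟨b, hab⟩, ha⟩, Or.inl (Sym2.mem_mk_left a b)⟩

/-! ### The local and global conditions are sufficient -/

section Sufficiency

variable [Finite V] {M : Finset (Sym2 V)}

/-- The set of tight edges. -/
noncomputable def tightEdges (G : SimpleGraph V) : Finset (Sym2 V) :=
  (Set.toFinite (Sym2.fromRel (tight_symm G))).toFinset

/-- The set of free vertices. -/
noncomputable def freeVerts (G : SimpleGraph V) : Finset V :=
  (Set.toFinite {v | Free G v}).toFinset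

lemma mem_tightEdges {a b : V} : s(a, b) ∈ tightEdges G ↔ Tight G a b := by simp [tightEdges]

lemma mem_freeVerts {v : V} : v ∈ freeVerts G ↔ Free G v := by simp [freeVerts]

lemma exposed_tightEdges {v : V} : Exposed (tightEdges G) v ↔ ¬ Covered G v := by
  rw [← not_iff_not, not_exposed_iff, not_not]
  simp only [mem_tightEdges, Covered]

namespace LocallyGood

lemma isMatching_tightEdges (h : LocallyGood G) : IsMatching G (tightEdges G) := by
  refine ⟨fun e he => ?_, ?_⟩
  · induction e with | _ a b
    exact (mem_tightEdges.1 he).1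
  · rintro e he f hf hne v ⟨⟨x, rfl⟩, ⟨y, rfl⟩⟩
    exact hne (by rw [h.unique v x y (mem_tightEdges.1 he) (mem_tightEdges.1 hf)])

lemma card_le_card_tightEdges (h : LocallyGood G) (hM : IsMatching G M) :
    M.card ≤ (tightEdges G).card := by
  refine Finset.card_le_card_of_forall_subsingleton (fun e t => ∃ v, v ∈ e ∧ v ∈ t)
    (fun e he => ?_) fun t ht e he f hf => ?_
  · induction e with | _ a b
    rcases h.cover a b (hM.1 _ he) with ⟨c, hc⟩ | ⟨c, hc⟩
    · exact ⟨_, mem_tightEdges.2 hc, a, Sym2.mem_mk_left a b, Sym2.mem_mk_left a c⟩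
    · exact ⟨_, mem_tightEdges.2 hc, b, Sym2.mem_mk_right a b, Sym2.mem_mk_left b c⟩
  · induction t with | _ a b
    obtain ⟨he, v, hve, hvt⟩ := he
    obtain ⟨hf, w, hwf, hwt⟩ := hf
    obtain ⟨x, hxe, hxf⟩ := (mem_tightEdges.1 ht).exists_common (hM.1 e he) (hM.1 f hf)
      (by rcases Sym2.mem_iff.1 hvt with rfl | rfl <;> simp only [hve, true_or, or_true])
      (by rcases Sym2.mem_iff.1 hwt with rfl | rfl <;> simp only [hwf, true_or, or_true])
    exact hM.eq_of_mem he hf hxe hxf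

lemma isMaximumMatching_tightEdges (h : LocallyGood G) : IsMaximumMatching G (tightEdges G) :=
  ⟨h.isMatching_tightEdges, h.isMatching_tightEdges.card_le.antisymm
    (matchingNumber_le fun _ hM => h.card_le_card_tightEdges hM)⟩

lemma card_le_card_freeVerts (h : LocallyGood G) (hM : IsMatching G M)
    (hd : Disjoint M (tightEdges G)) : M.card ≤ (freeVerts G).card := by
  refine Finset.card_le_card_of_forall_subsingleton
    (fun e v => v ∈ e ∨ ∀ x, G.Adj v x → x ∈ e) (fun e he => ?_) fun v hv e he f hf => ?_
  · induction e with | _ a b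
    obtain ⟨v, hv, hve⟩ := h.exists_free_of_adj (hM.1 _ he)
      fun ht => Finset.disjoint_left.1 hd he (mem_tightEdges.2 ht)
    exact ⟨v, mem_freeVerts.2 hv, hve⟩
  · obtain ⟨he, hve⟩ := he
    obtain ⟨hf, hvf⟩ := hf
    suffices ∃ x, x ∈ e ∧ x ∈ f by
      obtain ⟨x, hxe, hxf⟩ := this
      exact hM.eq_of_mem he hf hxe hxf
    have hother : ∀ g ∈ M, v ∈ g → ∃ x, G.Adj v x ∧ x ∈ g := by
      rintro g hg ⟨x, rfl⟩
      exact ⟨x, hM.1 _ hg, Sym2.mem_mk_right v x⟩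
    rcases hve with hve | hve <;> rcases hvf with hvf | hvf
    · exact ⟨v, hve, hvf⟩
    · obtain ⟨x, hvx, hxe⟩ := hother e he hve
      exact ⟨x, hxe, hvf x hvx⟩
    · obtain ⟨x, hvx, hxf⟩ := hother f hf hvf
      exact ⟨x, hve x hvx, hxf⟩
    · obtain ⟨x, hvx⟩ := (mem_freeVerts.1 hv).1
      exact ⟨x, hve x hvx, hvf x hvx⟩

lemma exists_extremal (h : LocallyGood G) (hs : HasSystem G) :
    ∃ s, Extremal G (tightEdges G) (freeVerts G) s := by
  obtain ⟨s, hadj, hdis⟩ := hs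
  refine ⟨s, ⟨h.isMaximumMatching_tightEdges,
    fun v hv => exposed_tightEdges.2 (mem_freeVerts.1 hv).2,
    fun v hv b => hadj v b (mem_freeVerts.1 hv), fun v hv w hw b c e he hve hwe => ?_⟩, ?_⟩
  · refine hdis v b w c (mem_freeVerts.1 hv) (mem_freeVerts.1 hw)
      (or_iff_not_imp_left.2 fun hne => ?_)
    rwa [(Sym2.mem_and_mem_iff hne).1 ⟨hve, hwe⟩, mem_tightEdges] at he
  · refine matchingNumber_le fun M hM => ?_
    obtain ⟨hM, hd⟩ := isMatching_deleteEdges.1 hM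
    exact h.card_le_card_freeVerts hM hd

end LocallyGood

end Sufficiency

/-! ### The local and global conditions are necessary -/

namespace Extremal

variable {F : Finset (Sym2 V)} {Y : Finset V} {s : V → Bool → V} {a b v : V}

lemma pair_notMem (h : Extremal G F Y s) (hv : v ∈ Y) (c : Bool) : s(s v c, s v (!c)) ∉ F :=
  fun hm => by
    simpa using (h.distinct v hv v hv c (!c) _ hm (Sym2.mem_mk_left _ _) (Sym2.mem_mk_right _ _)).2

lemma notMem_of_mem (h : Extremal G F Y s) (hab : s(a, b) ∈ F) : a ∉ Y :=
  fun ha => (h.exposed a ha).notMem_mk hab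

lemma ne_of_mem (h : Extremal G F Y s) (hv : v ∈ Y) {p : V} (hp : s(a, p) ∈ F) : p ≠ v := by
  rintro rfl
  exact (h.exposed p hv).notMem_mk (Sym2.eq_swap ▸ hp)

variable [Finite V]

lemma exists_eq_of_adj (h : Extremal G F Y s) {f : V → V} (hf : ∀ v ∈ Y, G.Adj v (f v))
    (hi : ∀ v ∈ Y, ∀ w ∈ Y, f v = f w → v = w) (hab : G.Adj a b) (hF : s(a, b) ∉ F)
    (ha : a ∉ Y) (hb : b ∉ Y) : ∃ v ∈ Y, f v = a ∨ f v = b := by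
  classical
  by_contra! hne
  have hfY : ∀ v ∈ Y, f v ∉ Y := fun v hv => h.notMem_of_adj hv (hf v hv)
  have hexp : ∀ x ∈ s(a, b), Exposed (starEdges Y f) x := fun x hx => by
    rcases Sym2.mem_iff.1 hx with rfl | rfl
    · exact exposed_starEdges ha fun v hv => (hne v hv).1.symm
    · exact exposed_starEdges hb fun v hv => (hne v hv).2.symm
  have hcard := (((isMatching_starEdges hf hfY hi).insert hab hexp).card_le_deleteEdges
    (Finset.disjoint_insert_left.2 ⟨hF, disjoint_starEdges h.exposed⟩)).trans h.card_le
  rw [Finset.card_insert_of_notMem (notMem_of_exposed hexp), card_starEdges hfY] at hcard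
  omega

lemma exists_eq_pair (h : Extremal G F Y s) (hab : G.Adj a b) (hF : s(a, b) ∉ F) (ha : a ∉ Y)
    (hb : b ∉ Y) : ∃ v ∈ Y, ∃ c, a = s v c ∧ b = s v (!c) := by
  by_contra! hpair
  have havoid : ∀ v ∈ Y, ∃ c, s v c ≠ a ∧ s v c ≠ b := fun v hv => by
    have hne : s v true ≠ s v false := fun e => by simpa using (h.injective hv hv e).2
    by_contra! hc
    by_cases ha : s v true = a
    · exact hpair v hv true ha.symm (hc false (ha ▸ hne.symm)).symm
    · have hb' : s v true = b := hc true ha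
      have ha' : s v false = a := by_contra fun hne' => hne (hb'.trans (hc false hne').symm)
      exact hpair v hv false ha'.symm hb'.symm
  choose! c hc using havoid
  obtain ⟨v, hv, hv'⟩ := h.exists_eq_of_adj (f := fun v => s v (c v)) (fun v hv => h.adj v hv _)
    (fun v hv w hw e => (h.injective hv hw e).1) hab hF ha hb
  exact hv'.elim (hc v hv).1 (hc v hv).2

lemma eq_or_eq_of_adj (h : Extremal G F Y s) (hv : v ∈ Y) {c : Bool}
    (hc : G.Adj (s v c) (s v (!c))) {y : V} (hy : G.Adj v y) : y = s v c ∨ y = s v (!c) := by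
  by_contra! hne
  have hchoice : ∀ x ∈ Y, ∃ z, x = v ∧ z = y ∨ x ≠ v ∧ z ≠ y ∧ ∃ b, z = s x b := fun x hx => by
    by_cases hxv : x = v
    · exact ⟨y, Or.inl ⟨hxv, rfl⟩⟩
    · by_cases hxy : s x true = y
      · refine ⟨s x false, Or.inr ⟨hxv, fun e => ?_, false, rfl⟩⟩
        simpa using (h.injective hx hx (hxy.trans e.symm)).2
      · exact ⟨s x true, Or.inr ⟨hxv, hxy, true, rfl⟩⟩
  choose! f hf using hchoice
  have hadj : ∀ x ∈ Y, G.Adj x (f x) := fun x hx => by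
    rcases hf x hx with ⟨rfl, hfx⟩ | ⟨-, -, b, hfx⟩
    · rwa [hfx]
    · exact hfx ▸ h.adj x hx b
  have hinj : ∀ x ∈ Y, ∀ z ∈ Y, f x = f z → x = z := fun x hx z hz e => by
    rcases hf x hx with ⟨rfl, hfx⟩ | ⟨-, hfxy, b, hfx⟩ <;>
      rcases hf z hz with ⟨rfl, hfz⟩ | ⟨-, hfzy, d, hfz⟩
    · rfl
    · exact absurd (e.symm.trans hfx) hfzy
    · exact absurd (e.trans hfz) hfxy
    · exact (h.injective hx hz (hfx.symm.trans (e.trans hfz))).1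
  obtain ⟨w, hw, hfw⟩ := h.exists_eq_of_adj hadj hinj hc (h.pair_notMem hv c)
    (h.notMem_of_adj hv (h.adj v hv _)) (h.notMem_of_adj hv (h.adj v hv _))
  rcases hf w hw with ⟨-, hfy⟩ | ⟨hwv, -, b, hfb⟩
  · exact hfw.elim (hne.1 <| hfy.symm.trans ·) (hne.2 <| hfy.symm.trans ·)
  · exact hwv (hfw.elim (fun e => (h.injective hw hv (hfb.symm.trans e)).1)
      fun e => (h.injective hw hv (hfb.symm.trans e)).1)

lemma mem_or_exists_eq_pair (h : Extremal G F Y s) {x : V} (hab : s(a, b) ∈ F)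
    (hax : G.Adj a x) (hxb : x ≠ b) : x ∈ Y ∨ ∃ v ∈ Y, ∃ c, a = s v c ∧ x = s v (!c) :=
  or_iff_not_imp_left.2 fun hx =>
    h.exists_eq_pair hax (fun hm => hxb (h.isMaximum.1.right_unique hm hab))
      (h.notMem_of_mem hab) hx

lemma exists_mem_adj (h : Extremal G F Y s) {x : V} (hab : s(a, b) ∈ F) (hax : G.Adj a x)
    (hxb : x ≠ b) : ∃ v ∈ Y, G.Adj v a := by
  rcases h.mem_or_exists_eq_pair hab hax hxb with hx | ⟨v, hv, c, rfl, -⟩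
  · exact ⟨x, hx, hax.symm⟩
  · exact ⟨v, hv, h.adj v hv c⟩

lemma eq_of_adj (h : Extremal G F Y s) {x : V} (hab : s(a, b) ∈ F) (hv : v ∈ Y)
    (hvb : G.Adj v b) (hax : G.Adj a x) : x = b ∨ x = v := by
  refine or_iff_not_imp_left.2 fun hxb => ?_
  have heq : ∀ w ∈ Y, G.Adj w a → w = v := fun w hw hwa =>
    h.isMaximum.eq_of_adj_adj (h.exposed w hw) (h.exposed v hv) hab hwa hvb
  rcases h.mem_or_exists_eq_pair hab hax hxb with hx | ⟨w, hw, c, rfl, rfl⟩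
  · exact heq x hx hax.symm
  · obtain rfl := heq w hw (h.adj w hw c)
    rcases h.eq_or_eq_of_adj hv hax hvb with rfl | rfl
    · exact absurd rfl (show G.Adj _ _ from h.isMaximum.1.1 _ hab).ne
    · exact absurd rfl hxb

lemma tight_of_mem (h : Extremal G F Y s) (hab : s(a, b) ∈ F) : Tight G a b := by
  have hba : s(b, a) ∈ F := Sym2.eq_swap ▸ hab
  refine ⟨h.isMaximum.1.1 _ hab, ?_⟩
  by_cases ha : ∀ x, G.Adj a x → x = b
  · exact Or.inl ha
  by_cases hb : ∀ x, G.Adj b x → x = a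
  · exact Or.inr (Or.inl hb)
  push Not at ha hb
  obtain ⟨x, hax, hxb⟩ := ha
  obtain ⟨y, hby, hya⟩ := hb
  obtain ⟨v, hv, hva⟩ := h.exists_mem_adj hab hax hxb
  obtain ⟨w, hw, hwb⟩ := h.exists_mem_adj hba hby hya
  obtain rfl := h.isMaximum.eq_of_adj_adj (h.exposed v hv) (h.exposed w hw) hab hva hwb
  exact Or.inr (Or.inr ⟨v, hva.symm, hwb.symm, fun _ => h.eq_of_adj hab hv hwb,
    fun _ => h.eq_of_adj hba hv hva⟩)

lemma not_tight_of_mem (h : Extremal G F Y s) (hv : v ∈ Y) : ¬ Tight G v b := by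
  rintro ⟨hvb, htight⟩
  obtain ⟨p, hp⟩ := h.isMaximum.exists_partner (h.exposed v hv) hvb
  have hpv := h.ne_of_mem hv hp
  have hbp : G.Adj b p := h.isMaximum.1.1 _ hp
  rcases htight with hdeg | hdeg | ⟨c, -, -, hnbr, hnbr'⟩
  · have := (hdeg _ (h.adj v hv true)).trans (hdeg _ (h.adj v hv false)).symm
    simpa using (h.injective hv hv this).2
  · exact hpv (hdeg p hbp)
  · obtain rfl := (hnbr' p hbp).resolve_left hpv
    have hmem : ∀ d, s v d ∈ s(b, p) := fun d => Sym2.mem_iff.2 (hnbr _ (h.adj v hv d))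
    simpa using (h.distinct v hv v hv true false _ hp (hmem true) (hmem false)).2

lemma not_tight_pair (h : Extremal G F Y s) (hv : v ∈ Y) (c : Bool) :
    ¬ Tight G (s v c) (s v (!c)) := by
  rintro ⟨-, htight⟩
  obtain ⟨p, hp⟩ := h.exists_partner hv c
  have hadj : G.Adj _ p := h.isMaximum.1.1 _ hp
  have hpv := h.ne_of_mem hv hp
  have hpc : p ≠ s v (!c) := fun e => h.pair_notMem hv c (e ▸ hp)
  have hvc := h.adj v hv c
  have hvc' := h.adj v hv (!c)
  rcases htight with hdeg | hdeg | ⟨d, -, -, hnbr, -⟩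
  · exact hpc (hdeg p hadj)
  · exact hvc.ne (hdeg v hvc'.symm)
  · exact hpv (((hnbr p hadj).resolve_left hpc).trans
      ((hnbr v hvc.symm).resolve_left hvc'.ne).symm)

lemma tight_iff (h : Extremal G F Y s) : Tight G a b ↔ s(a, b) ∈ F := by
  refine ⟨fun ht => ?_, h.tight_of_mem⟩
  by_contra hF
  by_cases ha : a ∈ Y
  · exact h.not_tight_of_mem ha ht
  by_cases hb : b ∈ Y
  · exact h.not_tight_of_mem hb ht.symm
  obtain ⟨v, hv, c, rfl, rfl⟩ := h.exists_eq_pair ht.1 hF ha hb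
  exact h.not_tight_pair hv c ht

lemma covered_iff (h : Extremal G F Y s) : Covered G v ↔ ¬ Exposed F v := by
  simp only [Covered, not_exposed_iff, h.tight_iff]

lemma free_iff (h : Extremal G F Y s) : Free G v ↔ v ∈ Y := by
  refine ⟨fun ⟨⟨x, hx⟩, hcov⟩ => ?_,
    fun hv => ⟨⟨_, h.adj v hv true⟩, fun ⟨b, hb⟩ => h.not_tight_of_mem hv hb⟩⟩
  rw [h.covered_iff, not_not] at hcov
  obtain ⟨p, hp⟩ := h.isMaximum.exists_partner hcov hx
  by_contra hv
  obtain ⟨w, hw, c, rfl, -⟩ := h.exists_eq_pair hx hcov.notMem_mk hv (h.notMem_of_mem hp)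
  obtain ⟨q, hq⟩ := h.exists_partner hw c
  exact hcov.notMem_mk hq

lemma locallyGood (h : Extremal G F Y s) : LocallyGood G where
  unique a b c hb hc := h.isMaximum.1.right_unique (h.tight_iff.1 hb) (h.tight_iff.1 hc)
  cover a b hab := by
    refine or_iff_not_imp_left.2 fun ha => ?_
    rw [h.covered_iff, not_not] at ha
    exact h.covered_iff.2 (not_exposed_iff.2 (h.isMaximum.exists_partner ha hab))
  apex a b hab ht ha hb := by
    have hY : ∀ {x}, Covered G x → x ∉ Y := fun hx hxY => (h.free_iff.2 hxY).2 hx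
    obtain ⟨v, hv, c, rfl, rfl⟩ :=
      h.exists_eq_pair hab (fun hm => ht (h.tight_iff.2 hm)) (hY ha) (hY hb)
    exact ⟨v, h.free_iff.2 hv, h.adj v hv _, h.adj v hv _, fun x => h.eq_or_eq_of_adj hv hab⟩

lemma hasSystem (h : Extremal G F Y s) : HasSystem G := by
  refine ⟨s, fun v b hv => h.adj v (h.free_iff.1 hv) b, fun v b w c hv hw => ?_⟩
  rw [h.free_iff] at hv hw
  rintro (e | htight)
  · exact h.injective hv hw e
  · exact h.distinct v hv w hw b c _ (h.tight_iff.1 htight) (Sym2.mem_mk_left _ _)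
      (Sym2.mem_mk_right _ _)

end Extremal

theorem bigL_eq_two_mul_smallL_iff [Finite V] :
    bigL G = 2 * smallL G ↔ LocallyGood G ∧ HasSystem G := by
  rw [bigL_eq_two_mul_smallL_iff_exists_extremal]
  exact ⟨fun ⟨_, _, _, h⟩ => ⟨h.locallyGood, h.hasSystem⟩,
    fun h => ⟨_, _, h.1.exists_extremal h.2⟩⟩

end MatchingPairs

/-! ### Bipartite matching by auction -/

lemma foldl_fixed_or_lt {ι σ : Type*} (Φ : σ → ℕ) {g : σ → ι → σ}
    (hg : ∀ s i, g s i = s ∨ Φ s < Φ (g s i)) (l : List ι) (s : σ) :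
    (l.foldl g s = s ∧ ∀ i ∈ l, g s i = s) ∨ Φ s < Φ (l.foldl g s) := by
  induction l generalizing s with
  | nil => simp
  | cons i l ih =>
    rw [List.foldl_cons, List.forall_mem_cons]
    rcases hg s i with hi | hi
    · rw [hi]
      exact (ih s).imp_left fun h => ⟨h.1, rfl, h.2⟩
    · rcases ih (g s i) with ⟨h, -⟩ | h
      · exact Or.inr (h.symm ▸ hi)
      · exact Or.inr (hi.trans h)

lemma iterate_fixed_or_le {σ : Type*} (Φ : σ → ℕ) {g : σ → σ}
    (hg : ∀ s, g s = s ∨ Φ s < Φ (g s)) (s : σ) (T : ℕ) :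
    g (g^[T] s) = g^[T] s ∨ T ≤ Φ (g^[T] s) := by
  induction T with
  | zero => exact Or.inr (Nat.zero_le _)
  | succ T ih =>
    rw [Function.iterate_succ_apply']
    rcases ih with h | h
    · exact Or.inl (congrArg g h)
    · rcases hg (g^[T] s) with h' | h'
      · exact Or.inl (congrArg g h')
      · exact Or.inr (h.trans_lt h')

/-- The state of an auction: the owner, if any, and the price of each object. -/
structure Auction (L R : Type*) where
  own : R → Option L
  price : R → ℕ

namespace Auction

variable {L R : Type*}

/-- The initial state, where all objects are free of charge and have no owner. -/
def start : Auction L R := ⟨fun _ => none, fun _ => 0⟩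

/-- The bidder `l` owns an object. -/
def Owns (s : Auction L R) (l : L) : Prop := ∃ f, s.own f = some l

/-- The objects acceptable to `l` are the `f` with `E l f`. The bidder `l` may bid for `f` if `l`
owns nothing and `f` is a cheapest object acceptable to `l`. -/
def CanBid (E : L → R → Prop) (s : Auction L R) (l : L) (f : R) : Prop :=
  ¬ s.Owns l ∧ E l f ∧ ∀ g, E l g → s.price f ≤ s.price g

/-- The map `m` assigns distinct acceptable objects to all bidders for whom some object is
acceptable. -/
structure IsAssignment (E : L → R → Prop) (m : {l // ∃ f, E l f} → R) : Prop where
  injective : Function.Injective m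
  acceptable : ∀ l : {l // ∃ f, E l f}, E l (m l)

/-- The invariant of the auction: every object with an owner was bought as a cheapest acceptable one
at one unit below its current price, while the prices of the other objects only grew. -/
structure Inv (E : L → R → Prop) (s : Auction L R) : Prop where
  acceptable : ∀ f l, s.own f = some l → E l f
  unique : ∀ f g l, s.own f = some l → s.own g = some l → f = g
  price_eq_zero : ∀ f, s.own f = none → s.price f = 0
  price_le : ∀ f l, s.own f = some l → ∀ g, E l g → s.price f ≤ s.price g + 1

variable {E : L → R → Prop} {s : Auction L R} {l : L} {f : R}

lemma inv_start : Inv E (start : Auction L R) where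
  acceptable _ _ h := nomatch h
  unique _ _ _ h := nomatch h
  price_eq_zero _ _ := rfl
  price_le _ _ h := nomatch h

lemma Inv.exists_own_of_price_pos (h : Inv E s) (hf : 0 < s.price f) : ∃ l, s.own f = some l :=
  Option.ne_none_iff_exists'.1 fun hn => hf.ne' (h.price_eq_zero f hn)

section Bid

variable [DecidableEq R]

/-- The object `f` passes to `l`, and its price increases by one. -/
def sell (s : Auction L R) (l : L) (f : R) : Auction L R :=
  ⟨Function.update s.own f (some l), Function.update s.price f (s.price f + 1)⟩

open Classical in
/-- The bidder `l` buys `f`, if `l` may bid for it. -/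
noncomputable def bid (E : L → R → Prop) (s : Auction L R) (l : L) (f : R) : Auction L R :=
  if CanBid E s l f then s.sell l f else s

/-- The pairs in the list `ps` of bidders and objects are processed in turn. -/
noncomputable def sweep (E : L → R → Prop) (ps : List (L × R)) (s : Auction L R) : Auction L R :=
  ps.foldl (fun s p => bid E s p.1 p.2) s

lemma Inv.sell (h : Inv E s) (hb : CanBid E s l f) : Inv E (s.sell l f) := by
  obtain ⟨hown, hE, hmin⟩ := hb
  have hown' : ∀ g, s.own g ≠ some l := fun g hg => hown ⟨g, hg⟩
  constructor <;> simp only [Auction.sell, Function.update_apply]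
  · have := h.acceptable
    grind
  · have := h.unique
    grind
  · have := h.price_eq_zero
    grind
  · have := h.price_le
    grind

lemma Inv.bid (h : Inv E s) (l : L) (f : R) : Inv E (bid E s l f) := by
  unfold Auction.bid
  split_ifs with hb
  exacts [h.sell hb, h]

lemma iterate_sweep_induction {p : Auction L R → Prop} (hstart : p start)
    (hbid : ∀ s l f, p s → p (bid E s l f)) (ps : List (L × R)) (T : ℕ) :
    p ((sweep E ps)^[T] start) := by
  have hsweep : ∀ s, p s → p (sweep E ps s) := fun s hs =>
    List.foldlRecOn ps _ hs fun s hs q _ => hbid s q.1 q.2 hs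
  exact Function.Iterate.rec p hstart hsweep T

end Bid

section Bound

variable [Fintype L] {m : {l // ∃ f, E l f} → R}

open Classical in
/-- The bidders to whom a matching `m` assigns an object of price at least `c`. -/
noncomputable def expensive (s : Auction L R) (m : {l // ∃ f, E l f} → R) (c : ℕ) :
    Finset {l // ∃ f, E l f} :=
  Finset.univ.filter fun l => c ≤ s.price (m l)

lemma mem_expensive {c : ℕ} {k : {l // ∃ f, E l f}} : k ∈ s.expensive m c ↔ c ≤ s.price (m k) := by
  simp only [expensive, Finset.mem_filter_univ]

/-- The owners of the objects assigned to the bidders on the left, and in addition the bidder `k`,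
who owns nothing, belong to the set on the right. -/
lemma Inv.card_expensive_lt (h : Inv E s) (hm : IsAssignment E m)
    {k : {l // ∃ f, E l f}} (hk : ¬ s.Owns k) {c : ℕ} (hc : c ≤ s.price (m k)) :
    (s.expensive m (c + 1)).card < (s.expensive m c).card := by
  classical
  refine lt_of_le_of_lt ?_ (Finset.card_erase_lt_of_mem (mem_expensive.2 hc))
  refine Finset.card_le_card_of_forall_subsingleton (fun j l => s.own (m j) = some l.1)
    (fun j hj => ?_) fun l _ i hi' j hj => ?_
  · have hj := mem_expensive.1 hj
    obtain ⟨l, hl⟩ := h.exists_own_of_price_pos (Nat.zero_lt_of_lt hj)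
    have hlE := h.acceptable _ _ hl
    refine ⟨⟨l, _, hlE⟩, Finset.mem_erase.2 ⟨?_, mem_expensive.2 ?_⟩, hl⟩
    · rintro rfl
      exact hk ⟨_, hl⟩
    · exact Nat.le_of_succ_le_succ (hj.trans (h.price_le _ _ hl _ (hm.acceptable ⟨l, _, hlE⟩)))
  · exact hm.injective (h.unique _ _ _ hi'.2 hj.2)

lemma Inv.price_lt (h : Inv E s) (hm : IsAssignment E m)
    {k : {l // ∃ f, E l f}} (hk : ¬ s.Owns k) : s.price (m k) < Fintype.card L := by
  classical
  have hcard : ∀ c ≤ s.price (m k), (s.expensive m c).card + c ≤ Fintype.card L := by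
    intro c
    induction c with
    | zero => exact fun _ => (Finset.card_le_univ _).trans (Fintype.card_subtype_le _)
    | succ c ih =>
      intro hc
      have := h.card_expensive_lt hm hk (Nat.le_of_succ_le hc)
      have := ih (Nat.le_of_succ_le hc)
      omega
  have hpos := Finset.card_pos.2 ⟨k, mem_expensive (s := s) (m := m).2 le_rfl⟩
  have := hcard _ le_rfl
  omega

lemma Inv.price_le_bid [DecidableEq R] (h : Inv E s) (hm : IsAssignment E m)
    (hs : ∀ g, s.price g ≤ Fintype.card L) (l : L) (f g : R) :
    (Auction.bid E s l f).price g ≤ Fintype.card L := by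
  unfold Auction.bid
  split_ifs with hb
  · rcases eq_or_ne g f with rfl | hgf
    · obtain ⟨hl, hE, hmin⟩ := hb
      simp only [Auction.sell, Function.update_self]
      exact (hmin _ (hm.acceptable ⟨l, _, hE⟩)).trans_lt (h.price_lt hm (k := ⟨l, _, hE⟩) hl)
    · simpa only [Auction.sell, Function.update_of_ne hgf] using hs g
  · exact hs g

end Bound

variable [DecidableEq R] {ps : List (L × R)}

section Total

variable [Fintype R]

/-- The sum of the prices. -/
def total (s : Auction L R) : ℕ := ∑ f, s.price f

lemma total_lt_total_bid (h : CanBid E s l f) : s.total < (bid E s l f).total := by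
  rw [bid, if_pos h]
  have hlt : s.price f < (s.sell l f).price f := by simp [sell]
  refine Finset.sum_lt_sum (fun g _ => ?_) ⟨f, Finset.mem_univ f, hlt⟩
  rcases eq_or_ne g f with rfl | hgf
  · exact hlt.le
  · simp [sell, Function.update_of_ne hgf]

lemma bid_fixed_or_lt (s : Auction L R) (l : L) (f : R) :
    bid E s l f = s ∨ s.total < (bid E s l f).total :=
  (em (CanBid E s l f)).symm.imp (fun h => if_neg h) total_lt_total_bid

lemma sweep_fixed_or_lt (ps : List (L × R)) (s : Auction L R) :
    (sweep E ps s = s ∧ ∀ p ∈ ps, bid E s p.1 p.2 = s) ∨ s.total < (sweep E ps s).total :=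
  foldl_fixed_or_lt total (fun s p => bid_fixed_or_lt s p.1 p.2) ps s

end Total

lemma owns_of_sweep_eq [Finite R] (hps : ∀ p, p ∈ ps) (hs : sweep E ps s = s) (hlf : E l f) :
    s.Owns l := by
  classical
  have := Fintype.ofFinite R
  by_contra hown
  obtain ⟨g, hg, hmin⟩ := Finset.exists_min_image (Finset.univ.filter (E l)) s.price
    ⟨f, (Finset.mem_filter_univ f).2 hlf⟩
  simp only [Finset.mem_filter_univ] at hg hmin
  have hlt := total_lt_total_bid (E := E) ⟨hown, hg, hmin⟩
  rcases sweep_fixed_or_lt (E := E) ps s with ⟨-, hfixed⟩ | hlt'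
  · exact hlt.ne (congrArg total (hfixed (l, g) (hps _)).symm)
  · exact hlt'.ne (congrArg total hs.symm)

variable [Fintype R] [Fintype L] {m : {l // ∃ f, E l f} → R} {T : ℕ}

lemma owns_iterate_sweep (hm : IsAssignment E m) (hps : ∀ p, p ∈ ps)
    (hT : Fintype.card R * Fintype.card L < T) (hlf : E l f) :
    ((sweep E ps)^[T] start).Owns l := by
  have hprice : ∀ g, ((sweep E ps)^[T] start).price g ≤ Fintype.card L :=
    (iterate_sweep_induction (p := fun s => Inv E s ∧ ∀ g, s.price g ≤ Fintype.card L)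
      ⟨inv_start, fun _ => Nat.zero_le _⟩
      (fun s l f hs => ⟨hs.1.bid l f, hs.1.price_le_bid hm hs.2 l f⟩) ps T).2
  have hsweep : ∀ s, sweep E ps s = s ∨ s.total < (sweep E ps s).total := fun s =>
    (sweep_fixed_or_lt ps s).imp_left And.left
  rcases iterate_fixed_or_le total hsweep start T with hfixed | hle
  · exact owns_of_sweep_eq hps hfixed hlf
  · have htotal : ((sweep E ps)^[T] start).total ≤ Fintype.card R * Fintype.card L :=
      Finset.sum_le_card_nsmul _ _ _ fun f _ => hprice f
    omega

theorem forall_owns_iterate_sweep_iff (hps : ∀ p, p ∈ ps)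
    (hT : Fintype.card R * Fintype.card L < T) :
    (∀ l, (∃ f, E l f) → ((sweep E ps)^[T] start).Owns l) ↔
      ∃ m, IsAssignment E m := by
  refine ⟨fun h => ?_, fun ⟨m, hm⟩ l ⟨f, hf⟩ => owns_iterate_sweep hm hps hT hf⟩
  have hinv : Inv E ((sweep E ps)^[T] start) :=
    iterate_sweep_induction inv_start (fun _ l f hs => hs.bid l f) ps T
  choose m hm using fun l : {l // ∃ f, E l f} => h l l.2
  exact ⟨m, fun k l e => Subtype.ext (Option.some_injective _ ((hm k).symm.trans (e ▸ hm l))),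
    fun l => hinv.acceptable _ _ (hm l)⟩

end Auction

namespace MatchingPairs

/-! ### Systems of neighbours as matchings of a bipartite graph -/

variable {V : Type*} {G : SimpleGraph V} {a b p q v : V}

lemma LocallyGood.covered_of_adj (h : LocallyGood G) (hv : Free G v) (hva : G.Adj v a) :
    Covered G a :=
  (h.cover v a hva).resolve_left hv.2

variable [LinearOrder V]

/-- In the auction, the bidders are two copies of each free vertex, and the objects are the tight
edges, each represented by its smaller end. A copy of `v` can use the tight edges at the neighbours
of `v`. -/
def Usable (G : SimpleGraph V) (l : V × Bool) (f : V) : Prop :=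
  Free G l.1 ∧ ∃ a p, G.Adj l.1 a ∧ Tight G a p ∧ f = min a p

namespace LocallyGood

lemma exists_usable_iff (h : LocallyGood G) {l : V × Bool} :
    (∃ f, Usable G l f) ↔ Free G l.1 := by
  refine ⟨fun ⟨_, hf⟩ => hf.1, fun hl => ?_⟩
  obtain ⟨a, ha⟩ := hl.1
  obtain ⟨p, hp⟩ := h.covered_of_adj hl ha
  exact ⟨_, hl, a, p, ha, hp, rfl⟩

lemma min_eq_min_iff (h : LocallyGood G) (hap : Tight G a p) (hbq : Tight G b q) :
    min a p = min b q ↔ a = b ∨ Tight G a b := by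
  constructor
  · intro e
    rcases min_choice a p with e₁ | e₁ <;> rcases min_choice b q with e₂ | e₂ <;> rw [e₁, e₂] at e
    · exact Or.inl e
    · exact Or.inr (e ▸ hbq.symm)
    · exact Or.inr (e ▸ hap)
    · exact Or.inl (h.unique p a b hap.symm (e ▸ hbq.symm))
  · rintro (rfl | hab)
    · rw [h.unique a p q hap hbq]
    · rw [h.unique a p b hap hab, h.unique b q a hbq hab.symm, min_comm]

lemma exists_isAssignment (h : LocallyGood G) (hG : HasSystem G) :
    ∃ m, Auction.IsAssignment (Usable G) m := by
  obtain ⟨s, hadj, hdis⟩ := hG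
  have hfree : ∀ l : {l // ∃ f, Usable G l f}, Free G l.1.1 := fun l => h.exists_usable_iff.1 l.2
  choose p hp using fun l : {l // ∃ f, Usable G l f} =>
    h.covered_of_adj (hfree l) (hadj l.1.1 l.1.2 (hfree l))
  refine ⟨fun l => min (s l.1.1 l.1.2) (p l), fun k l e => ?_,
    fun l => ⟨hfree l, _, _, hadj _ _ (hfree l), hp l, rfl⟩⟩
  have heq := hdis _ _ _ _ (hfree k) (hfree l) ((h.min_eq_min_iff (hp k) (hp l)).1 e)
  exact Subtype.ext (Prod.ext heq.1 heq.2)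

lemma hasSystem_of_isAssignment (h : LocallyGood G) {m : {l // ∃ f, Usable G l f} → V}
    (hm : Auction.IsAssignment (Usable G) m) : HasSystem G := by
  have hexists : ∀ v b, ∃ a, ∀ hv : Free G v, G.Adj v a ∧
      ∃ p, Tight G a p ∧ m ⟨(v, b), h.exists_usable_iff.2 hv⟩ = min a p := by
    intro v b
    by_cases hv : Free G v
    · obtain ⟨-, a, p, ha, hap, e⟩ := hm.acceptable ⟨(v, b), h.exists_usable_iff.2 hv⟩
      exact ⟨a, fun _ => ⟨ha, p, hap, e⟩⟩
    · exact ⟨v, fun hv' => absurd hv' hv⟩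
  choose s hs using hexists
  refine ⟨s, fun v b hv => (hs v b hv).1, fun v b w c hv hw hvw => ?_⟩
  obtain ⟨-, p, hp, ep⟩ := hs v b hv
  obtain ⟨-, q, hq, eq⟩ := hs w c hw
  have heq := hm.injective (ep.trans (((h.min_eq_min_iff hp hq).2 hvw).trans eq.symm))
  exact Prod.ext_iff.1 (congrArg Subtype.val heq)

theorem hasSystem_iff (h : LocallyGood G) :
    HasSystem G ↔ ∃ m, Auction.IsAssignment (Usable G) m :=
  ⟨h.exists_isAssignment, fun ⟨_, hm⟩ => h.hasSystem_of_isAssignment hm⟩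

end LocallyGood

end MatchingPairs

namespace RAM

open MatchingPairs

/-! ### Formulas as expressions -/

namespace Expr

/-- The expression, read as a formula, is true: its value is not zero. -/
def Holds (n : ℕ) (m ρ : ℕ → ℕ) (e : Expr) : Prop := e.eval n m ρ ≠ 0

/-- Negation. -/
def not (e : Expr) : Expr := .ifz e (.const 1) (.const 0)

/-- Conjunction. -/
def and (a b : Expr) : Expr := .ifz a (.const 0) b

/-- Disjunction. -/
def or (a b : Expr) : Expr := .add a b

/-- Implication. -/
def imp (a b : Expr) : Expr := .ifz a (.const 1) b

/-- The existential quantifier over the numbers below the input size. -/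
def ex (x : ℕ) (e : Expr) : Expr := .sum x e

/-- The universal quantifier over the numbers below the input size. -/
def all (x : ℕ) (e : Expr) : Expr := not (ex x (not e))

/-- Inequality. -/
def le (a b : Expr) : Expr := not (.sub a b)

/-- Equality. -/
def eq (a b : Expr) : Expr := and (le a b) (le b a)

section Connectives

variable {n : ℕ} {m ρ : ℕ → ℕ}

@[simp] lemma holds_not (e : Expr) : Holds n m ρ (not e) ↔ ¬ Holds n m ρ e := by
  simp [Holds, not, eval]

@[simp] lemma holds_and (a b : Expr) :
    Holds n m ρ (and a b) ↔ Holds n m ρ a ∧ Holds n m ρ b := by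
  simp [Holds, and, eval]

@[simp] lemma holds_or (a b : Expr) :
    Holds n m ρ (or a b) ↔ Holds n m ρ a ∨ Holds n m ρ b := by
  simp only [Holds, or, eval]
  omega

@[simp] lemma holds_imp (a b : Expr) :
    Holds n m ρ (imp a b) ↔ (Holds n m ρ a → Holds n m ρ b) := by
  simp only [Holds, imp, eval]
  split_ifs with h <;> simp [h]

@[simp] lemma holds_ex (x : ℕ) (e : Expr) :
    Holds n m ρ (ex x e) ↔ ∃ i : Fin n, Holds n m (Function.update ρ x i) e := by
  simp only [Holds, ex, eval, ne_eq, Finset.sum_eq_zero_iff, Finset.mem_range, not_forall]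
  exact ⟨fun ⟨i, hi, h⟩ => ⟨⟨i, hi⟩, h⟩, fun ⟨i, h⟩ => ⟨i, i.2, h⟩⟩

@[simp] lemma holds_all (x : ℕ) (e : Expr) :
    Holds n m ρ (all x e) ↔ ∀ i : Fin n, Holds n m (Function.update ρ x i) e := by
  simp [all]

@[simp] lemma holds_le (a b : Expr) : Holds n m ρ (le a b) ↔ a.eval n m ρ ≤ b.eval n m ρ := by
  rw [le, holds_not, Holds, eval, not_not, Nat.sub_eq_zero_iff_le]

@[simp] lemma holds_eq (a b : Expr) : Holds n m ρ (eq a b) ↔ a.eval n m ρ = b.eval n m ρ := by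
  rw [eq, holds_and, holds_le, holds_le, le_antisymm_iff]

lemma holds_var_eq_var {x y : ℕ} {a b : Fin n} (hx : ρ x = a) (hy : ρ y = b) :
    Holds n m ρ (eq (.var x) (.var y)) ↔ a = b := by
  rw [holds_eq, eval, eval, hx, hy, Fin.ext_iff]

end Connectives

end Expr

theorem decidableInPolyTime_of_holds {Q : ∀ n : ℕ, SimpleGraph (Fin n) → Prop} (c : Cmd) (e : Expr)
    (h : ∀ n G, e.Holds n (c.eval n (fun _ => 0) (input G).mem) (fun _ => 0) ↔ Q n G) :
    DecidableInPolyTime Q := by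
  refine decidableInPolyTime_of_eval c e.not.not (fun n G hQ => ?_) fun n G hQ => ?_
  · simpa [Expr.not, Expr.eval, Expr.Holds] using (h n G).2 hQ
  · simpa [Expr.not, Expr.eval, Expr.Holds] using mt (h n G).1 hQ

/-! ### The local conditions as formulas -/

namespace Expr

/-- The product of the input size and the value of `x`. -/
def sizeMul (x : ℕ) : Expr := .sum (x + 1) (.var x)

/-- The vertices `x` and `y` are adjacent. -/
def adj (x y : ℕ) : Expr := .read (.add (sizeMul x) (.var y))

/-- All neighbours of the vertex `x` are among `y` and `z`. As in the formulas below, the number of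
a bound variable exceeds those of the free ones, so that none of them is captured. -/
def nbrsAmong (x y z : ℕ) : Expr :=
  let w := x + y + z + 1
  all w (imp (adj x w) (or (eq (.var w) (.var y)) (eq (.var w) (.var z))))

/-- The vertices `x` and `y` are the ends of a tight edge. -/
def tight (x y : ℕ) : Expr :=
  let z := x + y + 1
  and (adj x y) (or (nbrsAmong x y y) (or (nbrsAmong y x x)
    (ex z (and (adj x z) (and (adj y z) (and (nbrsAmong x y z) (nbrsAmong y x z)))))))

/-- The vertex `x` lies on a tight edge. -/
def covered (x : ℕ) : Expr := ex (x + 1) (tight x (x + 1))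

/-- The vertex `x` is free. -/
def free (x : ℕ) : Expr := and (ex (x + 1) (adj x (x + 1))) (not (covered x))

/-- The copies of the vertex `x` can use the tight edge with smaller end `y`. -/
def usable (x y : ℕ) : Expr :=
  let a := x + y + 1
  let p := x + y + 2
  -- `a - (a - p)` is the minimum of `a` and `p`
  and (free x) (ex a (ex p (and (adj x a) (and (tight a p)
    (eq (.var y) (.sub (.var a) (.sub (.var a) (.var p))))))))

/-- The tight edges form a matching. -/
def tightUnique : Expr :=
  all 0 (all 1 (all 2 (imp (tight 0 1) (imp (tight 0 2) (eq (.var 1) (.var 2))))))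

/-- Every edge meets a tight edge. -/
def tightCover : Expr := all 0 (all 1 (imp (adj 0 1) (or (covered 0) (covered 1))))

/-- Every edge that is not tight and joins two covered vertices lies in a triangle whose third
vertex is free and has degree two. -/
def freeApex : Expr :=
  all 0 (all 1 (imp (adj 0 1) (imp (not (tight 0 1)) (imp (covered 0) (imp (covered 1)
    (ex 2 (and (free 2) (and (adj 2 0) (and (adj 2 1) (nbrsAmong 2 0 1))))))))))

/-- The graph is locally good. -/
def locallyGood : Expr := and tightUnique (and tightCover freeApex)

/-- The memory `m` starts with the adjacency matrix of `G`. -/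
def HasGraph {n : ℕ} (G : SimpleGraph (Fin n)) (m : ℕ → ℕ) : Prop :=
  ∀ i j : Fin n, m (n * i + j) ≠ 0 ↔ G.Adj i j

lemma update_of_lt {ρ : ℕ → ℕ} {x z a i : ℕ} (hx : ρ x = a) (h : x < z) :
    Function.update ρ z i x = a := by
  rw [Function.update_of_ne h.ne, hx]

end Expr

namespace Expr.HasGraph

variable {n : ℕ} {m ρ : ℕ → ℕ} {G : SimpleGraph (Fin n)} {x y z : ℕ} {a b c : Fin n}

lemma holds_adj (hm : HasGraph G m) (hx : ρ x = a) (hy : ρ y = b) :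
    Holds n m ρ (adj x y) ↔ G.Adj a b := by
  rw [← hm a b]
  simp [Holds, adj, sizeMul, eval, hx, hy]

lemma holds_nbrsAmong (hm : HasGraph G m) (hx : ρ x = a) (hy : ρ y = b) (hz : ρ z = c) :
    Holds n m ρ (nbrsAmong x y z) ↔ ∀ w, G.Adj a w → w = b ∨ w = c := by
  simp only [nbrsAmong, holds_all, holds_imp, holds_or]
  refine forall_congr' fun w => imp_congr ?_ (or_congr ?_ ?_)
  · exact hm.holds_adj (update_of_lt hx (by omega)) (Function.update_self ..)
  · exact holds_var_eq_var (Function.update_self ..) (update_of_lt hy (by omega))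
  · exact holds_var_eq_var (Function.update_self ..) (update_of_lt hz (by omega))

lemma holds_tight (hm : HasGraph G m) (hx : ρ x = a) (hy : ρ y = b) :
    Holds n m ρ (tight x y) ↔ Tight G a b := by
  simp only [tight, Tight, holds_and, holds_or, holds_ex, hm.holds_adj hx hy,
    hm.holds_nbrsAmong hx hy hy, hm.holds_nbrsAmong hy hx hx, or_self]
  refine and_congr_right' (or_congr_right (or_congr_right (exists_congr fun c => ?_)))
  have hx' := update_of_lt (i := c) hx (show x < x + y + 1 by omega)
  have hy' := update_of_lt (i := c) hy (show y < x + y + 1 by omega)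
  have hz' : Function.update ρ (x + y + 1) c (x + y + 1) = c := Function.update_self ..
  rw [hm.holds_adj hx' hz', hm.holds_adj hy' hz', hm.holds_nbrsAmong hx' hy' hz',
    hm.holds_nbrsAmong hy' hx' hz']

lemma holds_covered (hm : HasGraph G m) (hx : ρ x = a) :
    Holds n m ρ (covered x) ↔ Covered G a := by
  rw [covered, holds_ex]
  exact exists_congr fun i =>
    hm.holds_tight (update_of_lt hx x.lt_add_one) (Function.update_self ..)

lemma holds_free (hm : HasGraph G m) (hx : ρ x = a) : Holds n m ρ (free x) ↔ Free G a := by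
  rw [free, holds_and, holds_not, holds_ex, hm.holds_covered hx]
  exact and_congr_left' (exists_congr fun i =>
    hm.holds_adj (update_of_lt hx x.lt_add_one) (Function.update_self ..))

lemma holds_usable (hm : HasGraph G m) {l : Fin n × Bool} (hx : ρ x = l.1) (hy : ρ y = b) :
    Holds n m ρ (usable x y) ↔ Usable G l b := by
  simp only [usable, Usable, holds_and, holds_ex, hm.holds_free hx]
  refine and_congr_right' (exists_congr fun a => exists_congr fun p => ?_)
  have ha : Function.update (Function.update ρ (x + y + 1) a) (x + y + 2) p (x + y + 1) = a :=
    update_of_lt (Function.update_self ..) (Nat.lt_add_one _)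
  have hp : Function.update (Function.update ρ (x + y + 1) a) (x + y + 2) p (x + y + 2) = p :=
    Function.update_self ..
  refine and_congr (hm.holds_adj ?_ ha) (and_congr (hm.holds_tight ha hp) ?_)
  · exact update_of_lt (update_of_lt hx (by omega)) (by omega)
  · have hb : Function.update (Function.update ρ (x + y + 1) a) (x + y + 2) p y = b :=
      update_of_lt (update_of_lt hy (by omega)) (by omega)
    rw [holds_eq, Fin.ext_iff, Fin.coe_min, ← Nat.sub_sub_eq_min]
    simp only [eval, ha, hp, hb]

lemma holds_tightUnique (hm : HasGraph G m) :
    Holds n m ρ tightUnique ↔ ∀ a b c, Tight G a b → Tight G a c → b = c := by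
  simp only [tightUnique, holds_all, holds_imp]
  refine forall_congr' fun a => forall_congr' fun b => forall_congr' fun c => ?_
  exact imp_congr (hm.holds_tight (by simp) (by simp))
    (imp_congr (hm.holds_tight (by simp) (by simp)) (holds_var_eq_var (by simp) (by simp)))

lemma holds_tightCover (hm : HasGraph G m) :
    Holds n m ρ tightCover ↔ ∀ a b, G.Adj a b → Covered G a ∨ Covered G b := by
  simp only [tightCover, holds_all, holds_imp, holds_or]
  refine forall_congr' fun a => forall_congr' fun b => ?_
  exact imp_congr (hm.holds_adj (by simp) (by simp))
    (or_congr (hm.holds_covered (by simp)) (hm.holds_covered (by simp)))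

lemma holds_freeApex (hm : HasGraph G m) :
    Holds n m ρ freeApex ↔ ∀ a b, G.Adj a b → ¬ Tight G a b → Covered G a → Covered G b →
      ∃ v, Free G v ∧ G.Adj v a ∧ G.Adj v b ∧ ∀ x, G.Adj v x → x = a ∨ x = b := by
  simp only [freeApex, holds_all, holds_imp, holds_not, holds_ex, holds_and]
  refine forall_congr' fun a => forall_congr' fun b => ?_
  refine imp_congr (hm.holds_adj (by simp) (by simp))
    (imp_congr (not_congr (hm.holds_tight (by simp) (by simp)))
      (imp_congr (hm.holds_covered (by simp)) (imp_congr (hm.holds_covered (by simp))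
        (exists_congr fun v => ?_))))
  exact and_congr (hm.holds_free (by simp)) (and_congr (hm.holds_adj (by simp) (by simp))
    (and_congr (hm.holds_adj (by simp) (by simp))
      (hm.holds_nbrsAmong (by simp) (by simp) (by simp))))

lemma holds_locallyGood (hm : HasGraph G m) : Holds n m ρ locallyGood ↔ LocallyGood G := by
  rw [locallyGood, holds_and, holds_and, hm.holds_tightUnique, hm.holds_tightCover,
    hm.holds_freeApex]
  exact ⟨fun ⟨hunique, hcover, hapex⟩ => ⟨hunique, hcover, hapex⟩,
    fun h => ⟨h.unique, h.cover, h.apex⟩⟩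

end Expr.HasGraph

/-! ### The auction as a command -/

namespace Expr

/-- The address of the owner of the object `x`; the owners follow the adjacency matrix. -/
def ownAddr (x : ℕ) : Expr := .add (.sum x .size) (.var x)

/-- The address of the price of the object `x`; the prices follow the owners. -/
def priceAddr (x : ℕ) : Expr := .add (.add (.sum x .size) .size) (.var x)

/-- The code of the copy `b` of the vertex `x`. -/
def bidder (b : Bool) (x : ℕ) : Expr := .add (.add (.var x) (.var x)) (.const (b.toNat + 1))

/-- The copy `b` of the vertex `x` owns an object. -/
def owns (b : Bool) (x : ℕ) : Expr := ex (x + 1) (eq (.read (ownAddr (x + 1))) (bidder b x))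

/-- The copy `b` of the vertex `x` may bid for the object `y`. -/
def canBid (b : Bool) (x y : ℕ) : Expr :=
  let z := x + y + 1
  and (not (owns b x)) (and (usable x y)
    (all z (imp (usable x z) (le (.read (priceAddr y)) (.read (priceAddr z))))))

/-- The graph is locally good, and all copies of free vertices own objects. -/
def accept : Expr :=
  and locallyGood (all 0 (imp (free 0) (and (owns false 0) (owns true 0))))

end Expr

namespace Cmd

open RAM.Expr

/-- The copy `b` of the vertex `x` bids for the object `y`. -/
def bid (b : Bool) (x y : ℕ) : Cmd :=
  .when (canBid b x y) (.seq (.store (ownAddr y) (bidder b x))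
    (.store (priceAddr y) (.add (.read (priceAddr y)) (.const 1))))

/-- All copies of all vertices bid for all objects. -/
def sweep : Cmd := .loop 0 (.seq (.loop 1 (bid false 0 1)) (.loop 1 (bid true 0 1)))

/-- The auction, with `1 + 2 n²` sweeps. -/
def auction : Cmd := .seq sweep (.loop 0 (.loop 0 (.seq sweep sweep)))

end Cmd

open RAM.Expr

section Auction

variable {n : ℕ} {G : SimpleGraph (Fin n)} {m ρ : ℕ → ℕ}

/-- The representation in the memory of the owner of an object. -/
def ownerCode : Option (Fin n × Bool) → ℕ
  | none => 0
  | some l => (l.1 + l.1) + (l.2.toNat + 1)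

lemma ownerCode_injective : Function.Injective (ownerCode : Option (Fin n × Bool) → ℕ) := by
  rintro (_ | ⟨k, _ | _⟩) (_ | ⟨k', _ | _⟩) <;>
    simp only [ownerCode, Option.some.injEq, Prod.mk.injEq, Fin.ext_iff, reduceCtorEq, and_true,
      and_false, Bool.toNat_true, Bool.toNat_false, imp_self] <;>
    omega

/-- The memory `m` holds the graph `G` and the state `s` of the auction. -/
structure Represents (G : SimpleGraph (Fin n)) (m : ℕ → ℕ) (s : Auction (Fin n × Bool) (Fin n)) :
    Prop where
  graph : HasGraph G m
  own : ∀ f : Fin n, m (n * n + f) = ownerCode (s.own f)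
  price : ∀ f : Fin n, m (n * n + n + f) = s.price f

lemma mul_add_lt_mul (i j : Fin n) : n * i + j < n * n := by
  simpa only [finProdFinEquiv_apply_val, add_comm] using (finProdFinEquiv (i, j)).2

lemma hasGraph_input (G : SimpleGraph (Fin n)) : HasGraph G (input G).mem := by
  intro i j
  simp only [input, ne_eq, ite_eq_right_iff, one_ne_zero, imp_false, not_not]
  refine ⟨fun ⟨i', j', e, h⟩ => ?_, fun h => ⟨i, j, by rw [mul_comm], h⟩⟩
  have : finProdFinEquiv (i, j) = finProdFinEquiv (i', j') := by
    rw [Fin.ext_iff, finProdFinEquiv_apply_val, finProdFinEquiv_apply_val]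
    linarith
  obtain ⟨rfl, rfl⟩ := Prod.ext_iff.1 (finProdFinEquiv.injective this)
  exact h

lemma input_mem_of_le (G : SimpleGraph (Fin n)) {a : ℕ} (ha : n * n ≤ a) :
    (input G).mem a = 0 := by
  refine if_neg ?_
  rintro ⟨i, j, rfl, -⟩
  exact (mul_comm (i : ℕ) n ▸ mul_add_lt_mul i j).not_ge ha

lemma represents_input (G : SimpleGraph (Fin n)) : Represents G (input G).mem Auction.start where
  graph := hasGraph_input G
  own f := input_mem_of_le G (by omega)
  price f := input_mem_of_le G (by omega)

namespace Represents

variable {s : Auction (Fin n × Bool) (Fin n)} {x y : ℕ} {k f : Fin n}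

lemma holds_owns (h : Represents G m s) (hx : ρ x = k) (b : Bool) :
    Holds n m ρ (owns b x) ↔ s.Owns (k, b) := by
  rw [owns, holds_ex]
  refine exists_congr fun f => ?_
  rw [holds_eq, ← ownerCode_injective.eq_iff, ← h.own]
  simp [eval, ownAddr, bidder, ownerCode, hx]

lemma holds_canBid (h : Represents G m s) (hx : ρ x = k) (hy : ρ y = f) (b : Bool) :
    Holds n m ρ (canBid b x y) ↔ Auction.CanBid (Usable G) s (k, b) f := by
  simp only [canBid, Auction.CanBid, holds_and, holds_not, holds_all, holds_imp, holds_le,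
    h.holds_owns hx, h.graph.holds_usable (l := (k, b)) hx hy]
  refine and_congr_right' (and_congr_right' (forall_congr' fun g => imp_congr ?_ ?_))
  · exact h.graph.holds_usable (update_of_lt hx (by omega)) (Function.update_self ..)
  · have hy' := update_of_lt (i := g) hy (show y < x + y + 1 by omega)
    rw [← h.price, ← h.price]
    simp [eval, priceAddr, hy']

lemma sell (h : Represents G m s) (l : Fin n × Bool) (f : Fin n) :
    Represents G (Function.update (Function.update m (n * n + f) (ownerCode (some l)))
      (n * n + n + f) (s.price f + 1)) (s.sell l f) where
  graph i j := by
    have := mul_add_lt_mul i j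
    rw [Function.update_of_ne (by omega), Function.update_of_ne (by omega)]
    exact h.graph i j
  own g := by
    rw [Function.update_of_ne (by omega)]
    rcases eq_or_ne g f with rfl | hgf
    · simp only [Auction.sell, Function.update_self]
    · rw [Function.update_of_ne (by rwa [Ne, Nat.add_left_cancel_iff, ← Fin.ext_iff]), h.own]
      simp only [Auction.sell, Function.update_of_ne hgf]
  price g := by
    rcases eq_or_ne g f with rfl | hgf
    · simp only [Auction.sell, Function.update_self]
    · rw [Function.update_of_ne (by rwa [Ne, Nat.add_left_cancel_iff, ← Fin.ext_iff]),
        Function.update_of_ne (by omega), h.price]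
      simp only [Auction.sell, Function.update_of_ne hgf]

lemma bid (h : Represents G m s) (hx : ρ x = k) (hy : ρ y = f) (b : Bool) :
    Represents G ((Cmd.bid b x y).eval n ρ m) (Auction.bid (Usable G) s (k, b) f) := by
  have hcan := h.holds_canBid hx hy b
  by_cases hb : Auction.CanBid (Usable G) s (k, b) f
  · have hne : n * n + n + (f : ℕ) ≠ n * n + f := by omega
    rw [Auction.bid, if_pos hb, Cmd.bid, Cmd.eval, if_neg (hcan.2 hb)]
    simpa [Cmd.eval, eval, ownAddr, priceAddr, bidder, hx, hy, ownerCode,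
      Function.update_of_ne hne, h.price] using h.sell (k, b) f
  · rw [Auction.bid, if_neg hb, Cmd.bid, Cmd.eval, if_pos (not_not.1 (mt hcan.1 hb))]
    exact h

end Represents

lemma Cmd.eval_loop (x : ℕ) (c : Cmd) : (Cmd.loop x c).eval n ρ m =
    (List.finRange n).foldl (fun m (i : Fin n) => c.eval n (Function.update ρ x i) m) m := by
  rw [Cmd.eval, ← List.map_coe_finRange_eq_range, List.foldl_map]

/-- The order in which the bids of a sweep are made. -/
def bids (n : ℕ) : List ((Fin n × Bool) × Fin n) :=
  (List.finRange n).flatMap fun k =>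
    ((List.finRange n).map fun f => ((k, false), f)) ++
      (List.finRange n).map fun f => ((k, true), f)

lemma mem_bids (p : (Fin n × Bool) × Fin n) : p ∈ bids n := by
  obtain ⟨⟨k, _ | _⟩, f⟩ := p <;> simp [bids]

namespace Represents

variable {s : Auction (Fin n × Bool) (Fin n)}

lemma sweep (h : Represents G m s) :
    Represents G (Cmd.sweep.eval n ρ m) (Auction.sweep (Usable G) (bids n) s) := by
  rw [Cmd.sweep, Cmd.eval_loop, Auction.sweep, bids, List.foldl_flatMap]
  refine List.foldl_rel h fun k _ _ _ h => ?_
  rw [Cmd.eval, Cmd.eval_loop, Cmd.eval_loop, List.foldl_append, List.foldl_map, List.foldl_map]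
  exact List.foldl_rel (List.foldl_rel h fun f _ _ _ h => h.bid (by simp) (by simp) false)
    fun f _ _ _ h => h.bid (by simp) (by simp) true

lemma auction (h : Represents G m s) : Represents G (Cmd.auction.eval n ρ m)
    ((Auction.sweep (Usable G) (bids n))^[2 * (n * n) + 1] s) := by
  set g := Auction.sweep (Usable G) (bids n)
  have hiterate : g^[2 * (n * n) + 1] s = (List.finRange n).foldl (fun s _ =>
      (List.finRange n).foldl (fun s _ => g^[2] s) s) (g s) := by
    simp only [List.foldl_const, List.length_finRange, ← Function.iterate_mul]
    rw [Function.iterate_succ_apply, mul_assoc]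
  rw [hiterate, Cmd.auction, Cmd.eval, Cmd.eval_loop]
  refine List.foldl_rel h.sweep fun _ _ _ _ h => ?_
  rw [Cmd.eval_loop]
  exact List.foldl_rel h fun _ _ _ _ h => h.sweep.sweep

end Represents

theorem holds_accept (G : SimpleGraph (Fin n)) :
    Holds n (Cmd.auction.eval n ρ (input G).mem) ρ accept ↔ LocallyGood G ∧ HasSystem G := by
  have h := (represents_input G).auction (ρ := ρ)
  rw [accept, holds_and, h.graph.holds_locallyGood]
  refine and_congr_right fun hG => ?_
  have hcard : Fintype.card (Fin n) * Fintype.card (Fin n × Bool) < 2 * (n * n) + 1 := by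
    rw [Fintype.card_prod, Fintype.card_fin, Fintype.card_bool]
    linarith
  rw [hG.hasSystem_iff, ← Auction.forall_owns_iterate_sweep_iff mem_bids hcard, holds_all]
  simp only [hG.exists_usable_iff, Prod.forall, Bool.forall_bool]
  refine forall_congr' fun v => ?_
  have hv : Function.update ρ 0 v 0 = v := Function.update_self ..
  rw [holds_imp, holds_and, h.graph.holds_free hv, h.holds_owns hv, h.holds_owns hv, imp_and]

end Auction

end RAM

theorem mainTheorem3 :
    RAM.DecidableInPolyTime fun (n : ℕ) (G : SimpleGraph (Fin n)) =>
      MatchingPairs.bigL G = 2 * MatchingPairs.smallL G :=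
  RAM.decidableInPolyTime_of_holds RAM.Cmd.auction RAM.Expr.accept fun _ G =>
    (RAM.holds_accept G).trans MatchingPairs.bigL_eq_two_mul_smallL_iff.symm
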